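/- Let $0<d<k$ be integers and let $\mathbb{R}^k=\mathbb{R}^d\times\mathbb{R}^{k-d}$. For a linear map $L\colon\mathbb{R}^d\to\mathbb{R}^{k-d}$ let $E=\{(x,L(x)) : x\in\mathbb{R}^d\}$ be its graph, let $F_\rho=\{0\}^d\times\mathbb{R}^{k-d}$, and let $\rho$ be the projection of $\mathbb{R}^k$ onto $E$ along $F_\rho$. Let $F_\pi$ be a linear complement of $E$ in $\mathbb{R}^k$ and let $\pi,\pi^*$ be the projections onto $E$ and $F_\pi$ given by $\mathbb{R}^k=E+F_\pi$; it is assumed that $\pi$ is injective on $\mathbb{Z}^k$. Put $\mathcal{S}=\pi^*(\{0\}^d\times[0,1]^{k-d})+E$ and, for $s\in\mathbb{R}^k$, $Y_s=\pi(\mathcal{S}\cap(\mathbb{Z}^k+s))$ (a cubical cut and project set). Call $s$ regular if $\partial\mathcal{S}\cap(\mathbb{Z}^k+s)=\emptyset$. For $y\in Y=Y_s$ let $\tilde y$ be the unique point of $\mathbb{Z}^k+s$ with $\pi(\tilde y)=y$. For a bounded convex set $\Omega\subseteq E$ containing a neighbourhood of the origin in $E$ and for $r>0$, define the type I and type II patches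 of $Y$ at $y\in Y$ by $$P_{\mathrm I}(y,r\Omega)=\{y'\in Y : y'-y\in r\Omega\},\qquad P_{\mathrm{II}}(y,r\Omega)=\{y'\in Y : \tilde y'-\tilde y\in\rho^{-1}(r\Omega)\}.$$ Two patches $P(y_1,r\Omega)$, $P(y_2,r\Omega)$ of the same type are equivalent if $P(y_1,r\Omega)-y_1=P(y_2,r\Omega)-y_2$; write $\mathcal{P}(y,r\Omega)$ for the equivalence class. For a class $\mathcal{P}$, $y\in Y$ and $R>0$ put $$\xi_{\mathcal P}(y,R)=\frac{\#\{y'\in Y : \mathcal{P}(y',r\Omega)=\mathcal{P},\ \tilde y'-\tilde y\in[-R,R]^d\times\mathbb{R}^{k-d}\}}{\#\{y'\in Y : \tilde y'-\tilde y\in[-R,R]^d\times\mathbb{R}^{k-d}\}},\qquad \xi_{\mathcal P}=\lim_{R\to\infty}\xi_{\mathcal P}(y,R).$$ **Theorem.** Let $\epsilon>0$. For Lebesgue almost every linear map $L\colon\mathbb{R}^d\to\mathbb{R}^{k-d}$ and every $F_\pi$ as above there is a constant $C>0$, depending only on $L$, $\epsilon$ and $\pi$, such that the following holds for every bounded convex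 set $\Omega\subseteq E$ containing a neighbourhood of the origin in $E$. 1. For every $r>0$, every regular $s$ and every $y'\in Y=Y_s$, the class $\mathcal{P}=\mathcal{P}_{\mathrm{II}}(y',r\Omega)$ has a well-defined frequency $\xi_{\mathcal P}$ (the limit exists and has the same value for all regular $Y_{s'}$ and all base points in them), and for all $y\in Y$ and all $R\ge 2$ $$|\xi_{\mathcal P}(y,R)-\xi_{\mathcal P}|\le C\,\frac{(\log R)^{k+\epsilon}}{R^d}.$$ 2. There is $r_0>0$, which may depend on $\Omega$, such that for every $r\ge r_0$, every regular $s$ and every $y'\in Y=Y_s$, the class $\mathcal{P}=\mathcal{P}_{\mathrm{I}}(y',r\Omega)$ has a well-defined frequency $\xi_{\mathcal P}$ in the same sense, and for all $y\in Y$ and all $R\ge 2$ $$|\xi_{\mathcal P}(y,R)-\xi_{\mathcal P}|\le C\,\frac{(\log R)^{k+\epsilon}\,r^{(d-1)(k-d-1)}}{R^d}.$$ -/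

import Mathlib

open Filter Topology MeasureTheory
open scoped Pointwise

namespace CutProject

/-- The total space `ℝ^k = ℝ^d × ℝ^m`, where `m = k - d`. -/
abbrev TotalSpace (d m : ℕ) : Type := (Fin d → ℝ) × (Fin m → ℝ)

/-- The integer lattice `ℤ^k` in the total space. -/
def integerLattice (d m : ℕ) : Set (TotalSpace d m) :=
  {v | (∀ i, ∃ n : ℤ, v.1 i = n) ∧ ∀ j, ∃ n : ℤ, v.2 j = n}

/-- The translated lattice `ℤ^k + s`. -/
def shiftedLattice {d m : ℕ} (s : TotalSpace d m) : Set (TotalSpace d m) :=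
  {v | v - s ∈ integerLattice d m}

/-- The cylinder `C(R)` of lattice points whose first `d` coordinates lie in `[-R, R]`. -/
def cylinder (d m : ℕ) (R : ℝ) : Set (TotalSpace d m) :=
  {v | v ∈ integerLattice d m ∧ ∀ i, v.1 i ∈ Set.Icc (-R) R}

/-- The linear map `L : ℝ^d → ℝ^m` with coefficients `α`, `L(x)_i = ∑ j, α i j * x j`. -/
noncomputable def linMap {d m : ℕ} (α : Fin m → Fin d → ℝ) :
    (Fin d → ℝ) →ₗ[ℝ] (Fin m → ℝ) :=
  Matrix.mulVecLin (Matrix.of α)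

/-- The physical space `E = {(x, L x)}`. -/
noncomputable def physicalSpace {d m : ℕ} (α : Fin m → Fin d → ℝ) :
    Submodule ℝ (TotalSpace d m) :=
  (linMap α).graph

/-- The reference space `F_ρ = {0}^d × ℝ^m`. -/
def referenceSpace (d m : ℕ) : Submodule ℝ (TotalSpace d m) :=
  Submodule.prod ⊥ ⊤

theorem isCompl_referenceSpace {d m : ℕ} (α : Fin m → Fin d → ℝ) :
    IsCompl (physicalSpace α) (referenceSpace d m) := by
  constructor
  · rw [Submodule.disjoint_def]
    rintro ⟨x, z⟩ hE hF
    simp only [physicalSpace, LinearMap.mem_graph_iff] at hE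
    simp only [referenceSpace, Submodule.mem_prod, Submodule.mem_bot] at hF
    obtain ⟨rfl, -⟩ := hF
    simp [hE]
  · rw [codisjoint_iff, Submodule.eq_top_iff']
    rintro ⟨x, z⟩
    refine Submodule.mem_sup.2 ⟨(x, linMap α x), ?_, (0, z - linMap α x), ?_, ?_⟩
    · simp [physicalSpace, LinearMap.mem_graph_iff]
    · simp [referenceSpace]
    · simp

/-- The projection `ρ` onto `E` along the reference space `F_ρ`. -/
noncomputable def rho {d m : ℕ} (α : Fin m → Fin d → ℝ) :
    TotalSpace d m →ₗ[ℝ] TotalSpace d m :=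
  (physicalSpace α).projection (referenceSpace d m) (isCompl_referenceSpace α)

/-- The data of a cubical cut and project scheme with physical space the graph of `α`: an internal
space `F_π` complementary to `E`, such that the projection `π` onto `E` along `F_π` is injective
on `ℤ^k`. -/
structure CubicalScheme {d m : ℕ} (α : Fin m → Fin d → ℝ) where
  internal : Submodule ℝ (TotalSpace d m)
  isCompl : IsCompl (physicalSpace α) internal
  injOn : Set.InjOn ((physicalSpace α).projection internal isCompl) (integerLattice d m)

namespace CubicalScheme

variable {d m : ℕ} {α : Fin m → Fin d → ℝ} (D : CubicalScheme α)

/-- The projection `π` onto `E` along `F_π`. -/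
noncomputable def proj : TotalSpace d m →ₗ[ℝ] TotalSpace d m :=
  (physicalSpace α).projection D.internal D.isCompl

/-- The projection `π^*` onto `F_π` along `E`. -/
noncomputable def projStar : TotalSpace d m →ₗ[ℝ] TotalSpace d m :=
  D.internal.projection (physicalSpace α) D.isCompl.symm

/-- The cubical window `π^*({0}^d × [0,1]^m)` in `F_π`. -/
def window : Set (TotalSpace d m) :=
  D.projStar '' ({0} ×ˢ Set.Icc 0 1)

/-- The slice `𝒮 = 𝒲_π + E`. -/
def slice : Set (TotalSpace d m) :=
  D.window + (physicalSpace α : Set (TotalSpace d m))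

/-- The cut and project set `Y_s`. -/
def pointSet (s : TotalSpace d m) : Set (TotalSpace d m) :=
  D.proj '' (D.slice ∩ shiftedLattice s)

/-- `s` (equivalently `Y_s`) is regular: the boundary of the slice misses `ℤ^k + s`. -/
def IsRegular (s : TotalSpace d m) : Prop :=
  frontier D.slice ∩ shiftedLattice s = ∅

/-- For `y ∈ Y_s`, the unique element of `ℤ^k + s` that `π` maps to `y`. -/
noncomputable def lift (s y : TotalSpace d m) : TotalSpace d m :=
  Function.invFunOn D.proj (shiftedLattice s) y

/-- The type I patch of `Y_s` at `y` with shape `A`. -/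
def patchI (A : Set (TotalSpace d m)) (s y : TotalSpace d m) : Set (TotalSpace d m) :=
  {y' | y' ∈ D.pointSet s ∧ y' - y ∈ A}

/-- The type II patch of `Y_s` at `y` with shape `A`. -/
def patchII (A : Set (TotalSpace d m)) (s y : TotalSpace d m) : Set (TotalSpace d m) :=
  {y' | y' ∈ D.pointSet s ∧ D.lift s y' - D.lift s y ∈ rho α ⁻¹' A}

end CubicalScheme

/-- The equivalence class of the patch `P s y`, encoded by its translate `P s y - y`: two patches
are equivalent exactly when these translates agree. -/
def patchClass {d m : ℕ} (P : TotalSpace d m → TotalSpace d m → Set (TotalSpace d m))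
    (s y : TotalSpace d m) : Set (TotalSpace d m) :=
  (fun z => z - y) '' P s y

namespace CubicalScheme

variable {d m : ℕ} {α : Fin m → Fin d → ℝ} (D : CubicalScheme α)

/-- The points of `Y_s` in the box of size `R` around `y`. -/
def box (s y : TotalSpace d m) (R : ℝ) : Set (TotalSpace d m) :=
  {y' | y' ∈ D.pointSet s ∧ D.lift s y' - D.lift s y ∈ cylinder d m R}

/-- The proportion `ξ_𝒫(y, R)` of the points of `Y_s` in the box of size `R` around `y` whose patch
(with respect to the notion of patch `P`) has class `c`. -/
noncomputable def freqEstimate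
    (P : TotalSpace d m → TotalSpace d m → Set (TotalSpace d m))
    (c : Set (TotalSpace d m)) (s y : TotalSpace d m) (R : ℝ) : ℝ :=
  ({y' | y' ∈ D.box s y R ∧ patchClass P s y' = c}.ncard : ℝ) / ((D.box s y R).ncard : ℝ)

/-- `ξ` is the frequency of the class `c`: the limit of `ξ_𝒫(y, R)` as `R → ∞`, for every
regular `Y_s` and every `y ∈ Y_s`. -/
def HasFrequency
    (P : TotalSpace d m → TotalSpace d m → Set (TotalSpace d m))
    (c : Set (TotalSpace d m)) (ξ : ℝ) : Prop :=
  ∀ s : TotalSpace d m, D.IsRegular s → ∀ y ∈ D.pointSet s,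
    Tendsto (fun R : ℝ => D.freqEstimate P c s y R) atTop (𝓝 ξ)

end CubicalScheme

/-- A patch shape: a bounded convex subset of `E` that contains a neighbourhood of the origin
in `E`. -/
structure IsPatchShape {d m : ℕ} (α : Fin m → Fin d → ℝ) (Ω : Set (TotalSpace d m)) : Prop where
  subset : Ω ⊆ physicalSpace α
  bounded : Bornology.IsBounded Ω
  convex : Convex ℝ Ω
  nhds_zero : Ω ∈ 𝓝[(physicalSpace α : Set (TotalSpace d m))] 0

end CutProject

/-! Write m = k - d. Let y be a point of a regular `Y_s`, v its lift and w = v.2 - L v.1 its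
internal coordinate. Over each integer n exactly one lattice point v + (n, z) lies in the slice, and
its internal coordinate is the fractional part of w - L n. The translated patch at a point depends
only on that point's internal coordinate. A patch class therefore corresponds to an acceptance set
in [0,1)^m, and `ξ_𝒫(y, R)` is the proportion of n ∈ [-R,R]^d with {w - L n} in it. Two things are
needed: a discrepancy bound for boxes, uniform in w, and a count of the boxes that make up the
acceptance set.

Discrepancy (`ae_hasSmallDiscrepancy`). Indicators of intervals are smoothed at scale 1/H and
expanded in Fourier series. A frequency h ≠ 0 contributes at most a constant times ∏ `coeffBound`
times a product of d geometric sums. The average over L in a bounded box, summed over h, is O((log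
H)^m (log R)^d), and H of size R^d makes this (log R)^k. A weighted sum over the scales R = 2^(2^i)
has finite integral, which gives (log R)^(k+ε) for almost every L.

Boxes (`exists_box_cell`). As t runs through [0,1), ⌊t - β⌋ takes at most two values and is
monotone, so any condition on it defines an interval. For type II, whether a displacement belongs to
the patch depends on n alone, and the acceptance set is a box. For type I this holds except for the
n near the boundary of rΩ, of which there are O(r^(d-1)) by a volume comparison
(`exists_card_nearBoundary_le`). These cut every axis into O(r^(d-1)) intervals. Once the intervals
on m - 1 axes are fixed, the remaining condition concerns one coordinate and is again an interval.
This leaves O(r^((d-1)(m-1))) boxes.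

The implied constant depends on Ω, while C may not. It is absorbed by a spare power of log R when R
is large, and by the trivial bound 1 when R is small and r is large (`exists_forall_min_le`). -/

namespace CutProject

/-! ### Smoothed indicator functions of intervals modulo 1 -/

/-- The primitive of the floor function vanishing at `0`. -/
noncomputable def floorPrimitive (x : ℝ) : ℝ := ⌊x⌋ * x - ⌊x⌋ * (⌊x⌋ + 1) / 2

/-- The floor function is nondecreasing, so its primitive is convex; this is the supporting line at
x. -/
theorem floor_mul_sub_le (x y : ℝ) :
    ⌊x⌋ * (y - x) ≤ floorPrimitive y - floorPrimitive x := by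
  have key : (⌊x⌋ : ℝ) * y - ⌊x⌋ * (⌊x⌋ + 1) / 2 ≤ floorPrimitive y := by
    unfold floorPrimitive
    have h1 := Int.floor_le y
    have h2 := (Int.lt_floor_add_one y).le
    rcases lt_trichotomy ⌊x⌋ ⌊y⌋ with h | h | h
    · have h' : (⌊x⌋ : ℝ) + 1 ≤ ⌊y⌋ := by exact_mod_cast h
      nlinarith
    · rw [h]
    · have h' : (⌊y⌋ : ℝ) + 1 ≤ ⌊x⌋ := by exact_mod_cast h
      nlinarith
  have : floorPrimitive x = ⌊x⌋ * x - ⌊x⌋ * (⌊x⌋ + 1) / 2 := rfl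
  linarith

theorem floorPrimitive_eq_fract (x : ℝ) :
    floorPrimitive x = (x ^ 2 - x - (Int.fract x ^ 2 - Int.fract x)) / 2 := by
  unfold floorPrimitive
  rw [Int.fract]
  ring

/-- The mean of the floor function over `[x, x + δ]`. -/
noncomputable def smoothFloor (δ x : ℝ) : ℝ := (floorPrimitive (x + δ) - floorPrimitive x) / δ

theorem floor_le_smoothFloor {δ : ℝ} (hδ : 0 < δ) (x : ℝ) : (⌊x⌋ : ℝ) ≤ smoothFloor δ x := by
  rw [smoothFloor, le_div_iff₀ hδ]
  have := floor_mul_sub_le x (x + δ)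
  rwa [add_sub_cancel_left] at this

theorem smoothFloor_le_floor {δ : ℝ} (hδ : 0 < δ) (x : ℝ) : smoothFloor δ x ≤ ⌊x + δ⌋ := by
  rw [smoothFloor, div_le_iff₀ hδ]
  have := floor_mul_sub_le (x + δ) x
  linarith

/-- The convolution of the `ℤ`-periodic indicator function of `[p, q)` with the normalised
indicator function of an interval of length `δ`. -/
noncomputable def bump (δ p q x : ℝ) : ℝ := smoothFloor δ (x - p) - smoothFloor δ (x - q)

/-- When {x} ∈ [a, b], the whole averaging window [x, x + δ] stays in [a, b + 2δ) modulo 1. Widening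
by 2δ instead of δ supplies the strict inequality at the right end. -/
theorem indicator_le_bump {δ a b : ℝ} (hδ : 0 < δ) (hab : a ≤ b) {J : Set ℝ}
    (hJ : J ⊆ Set.Icc a b) (x : ℝ) :
    J.indicator 1 (Int.fract x) ≤ bump δ a (b + 2 * δ) x := by
  have h1 := floor_le_smoothFloor hδ (x - a)
  have h2 := smoothFloor_le_floor hδ (x - (b + 2 * δ))
  by_cases hx : Int.fract x ∈ J
  · rw [Set.indicator_of_mem hx, Pi.one_apply]
    have ha := (hJ hx).1
    have hb := (hJ hx).2
    have h3 : ⌊x⌋ ≤ ⌊x - a⌋ := by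
      rw [Int.le_floor]; have := Int.self_sub_floor x; linarith
    have h4 : ⌊x - (b + 2 * δ) + δ⌋ < ⌊x⌋ := by
      rw [Int.floor_lt]; have := Int.self_sub_floor x; linarith
    have h5 : (⌊x - (b + 2 * δ) + δ⌋ : ℝ) + 1 ≤ ⌊x - a⌋ := by
      exact_mod_cast (show ⌊x - (b + 2 * δ) + δ⌋ + 1 ≤ ⌊x - a⌋ by omega)
    unfold bump; linarith
  · rw [Set.indicator_of_notMem hx]
    have h5 : (⌊x - (b + 2 * δ) + δ⌋ : ℝ) ≤ ⌊x - a⌋ := by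
      exact_mod_cast Int.floor_le_floor (by linarith)
    unfold bump; linarith

theorem bump_le_indicator {δ a b : ℝ} (hδ : 0 < δ) (ha : 0 ≤ a) (hb : b ≤ 1) {J : Set ℝ}
    (hJ : Set.Ioo a b ⊆ J) (x : ℝ) :
    bump δ (a + 2 * δ) b x ≤ J.indicator 1 (Int.fract x) := by
  have h1 := smoothFloor_le_floor hδ (x - (a + 2 * δ))
  have h2 := floor_le_smoothFloor hδ (x - b)
  have hf := Int.self_sub_floor x
  have hf0 := Int.fract_nonneg x
  have hf1 := Int.fract_lt_one x
  have h3 : ⌊x⌋ ≤ ⌊x - b⌋ + 1 := by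
    rw [← Int.floor_add_one, Int.le_floor]; linarith
  have h4 : ⌊x - (a + 2 * δ) + δ⌋ ≤ ⌊x⌋ := Int.floor_le_floor (by linarith)
  have key : ∀ z : ℤ, ⌊x - (a + 2 * δ) + δ⌋ ≤ ⌊x - b⌋ + z → bump δ (a + 2 * δ) b x ≤ z := by
    intro z hz
    have : (⌊x - (a + 2 * δ) + δ⌋ : ℝ) ≤ ⌊x - b⌋ + z := by exact_mod_cast hz
    unfold bump; linarith
  by_cases hx : Int.fract x ∈ J
  · rw [Set.indicator_of_mem hx, Pi.one_apply]
    have := key 1 (by omega)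
    exact_mod_cast this
  · rw [Set.indicator_of_notMem hx]
    have : bump δ (a + 2 * δ) b x ≤ (0 : ℤ) := by
      apply key
      rcases le_or_gt (Int.fract x) a with h | h
      · have : ⌊x - (a + 2 * δ) + δ⌋ < ⌊x⌋ := by
          rw [Int.floor_lt]; linarith
        omega
      · have h' : b ≤ Int.fract x := by
          by_contra hc
          exact hx (hJ ⟨h, not_le.1 hc⟩)
        have : ⌊x⌋ ≤ ⌊x - b⌋ := by
          rw [Int.le_floor]; linarith
        omega
    exact_mod_cast this

theorem bump_nonneg {δ p q : ℝ} (hδ : 0 < δ) (h : p + δ ≤ q) (x : ℝ) : 0 ≤ bump δ p q x := by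
  have h1 := floor_le_smoothFloor hδ (x - p)
  have h2 := smoothFloor_le_floor hδ (x - q)
  have h5 : (⌊x - q + δ⌋ : ℝ) ≤ ⌊x - p⌋ := by
    exact_mod_cast Int.floor_le_floor (by linarith)
  unfold bump; linarith

/-! ### Fourier expansion of the smoothed indicators -/

/-- The character `x ↦ exp (2 π i x)`. -/
noncomputable def expChar (x : ℝ) : ℂ := Complex.exp (Complex.I * ((2 * Real.pi * x : ℝ) : ℂ))

theorem expChar_add (x y : ℝ) : expChar (x + y) = expChar x * expChar y := by
  rw [expChar, expChar, expChar, ← Complex.exp_add]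
  push_cast; ring_nf

theorem norm_expChar (x : ℝ) : ‖expChar x‖ = 1 := by
  rw [expChar, mul_comm, Complex.norm_exp_ofReal_mul_I]

theorem expChar_zero : expChar 0 = 1 := by simp [expChar]

theorem expChar_int (n : ℤ) : expChar n = 1 := by
  rw [expChar, Complex.exp_eq_one_iff]
  exact ⟨n, by push_cast; ring⟩

theorem expChar_sum {ι : Type*} (s : Finset ι) (f : ι → ℝ) :
    expChar (∑ i ∈ s, f i) = ∏ i ∈ s, expChar (f i) := by
  classical
  induction s using Finset.induction_on with
  | empty => simp [expChar_zero]
  | insert a s ha ih => rw [Finset.sum_insert ha, Finset.prod_insert ha, expChar_add, ih]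

theorem norm_expChar_sub_one (x : ℝ) : ‖expChar x - 1‖ = 2 * |Real.sin (Real.pi * x)| := by
  rw [expChar, Complex.norm_exp_I_mul_ofReal_sub_one, Real.norm_eq_abs, abs_mul, abs_two]
  congr 3; ring

theorem norm_expChar_sub_one_le (x : ℝ) : ‖expChar x - 1‖ ≤ 2 * Real.pi * |x| := by
  have := Real.norm_exp_I_mul_ofReal_sub_one_le (x := 2 * Real.pi * x)
  rw [expChar]
  rwa [Real.norm_eq_abs, abs_mul, abs_of_pos Real.two_pi_pos] at this

/-- This is the Fourier series of the second Bernoulli polynomial, extended periodically. It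
converges absolutely, which is the gain from smoothing. -/
theorem hasSum_fract (x : ℝ) :
    HasSum (fun n : ℤ => 1 / (n : ℂ) ^ 2 * expChar (n * x))
      ((2 * Real.pi ^ 2 * (Int.fract x ^ 2 - Int.fract x + 6⁻¹) : ℝ) : ℂ) := by
  have h := hasSum_one_div_pow_mul_fourier_mul_bernoulliFun le_rfl
    (x := Int.fract x) ⟨Int.fract_nonneg x, (Int.fract_lt_one x).le⟩
  convert h using 1
  · funext n
    rw [fourier_coe_apply]
    congr 1
    have : (n : ℝ) * x = (n * Int.fract x) + ((n * ⌊x⌋ : ℤ) : ℝ) := by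
      push_cast; rw [← mul_add, Int.fract_add_floor]
    rw [this, expChar_add, expChar_int, mul_one, expChar]
    congr 1; push_cast; ring
  · rw [bernoulliFun_two]
    push_cast
    rw [mul_pow, Complex.I_sq]
    simp only [Nat.factorial]; push_cast; ring

/-- The Fourier coefficients of `bump δ p q`. -/
noncomputable def bumpCoeff (δ p q : ℝ) (h : ℤ) : ℂ :=
  if h = 0 then ((q - p : ℝ) : ℂ)
  else -((1 / (4 * Real.pi ^ 2 * δ) : ℝ) : ℂ) * (1 / (h : ℂ) ^ 2) *
    ((expChar (h * δ) - 1) * (expChar (h * -p) - expChar (h * -q)))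

/-- By `floorPrimitive_eq_fract`, `bump` is a second difference of a quadratic polynomial minus the
periodic Bernoulli part. The quadratic contributes the constant q - p, and the rest is four shifts
of `hasSum_fract`. -/
theorem hasSum_bumpCoeff {δ : ℝ} (hδ : 0 < δ) (p q x : ℝ) :
    HasSum (fun h : ℤ => bumpCoeff δ p q h * expChar (h * x)) (bump δ p q x : ℂ) := by
  have h1 := hasSum_fract (x - p + δ)
  have h2 := hasSum_fract (x - p)
  have h3 := hasSum_fract (x - q + δ)
  have h4 := hasSum_fract (x - q)
  have h5 := (((h1.sub h2).sub (h3.sub h4)).mul_left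
    (-((1 / (4 * Real.pi ^ 2 * δ) : ℝ) : ℂ))).add
    (hasSum_ite_eq (0 : ℤ) ((q - p : ℝ) : ℂ))
  refine Eq.mpr (congrArg₂ (fun (f : ℤ → ℂ) a => HasSum f a) (funext fun h => ?_) ?_) h5
  · by_cases hh : h = 0
    · subst hh
      simp [bumpCoeff, expChar_zero]
    · rw [bumpCoeff, if_neg hh, if_neg hh, add_zero]
      have e1 : (h : ℝ) * (x - p + δ) = h * δ + h * -p + h * x := by ring
      have e2 : (h : ℝ) * (x - p) = h * -p + h * x := by ring
      have e3 : (h : ℝ) * (x - q + δ) = h * δ + h * -q + h * x := by ring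
      have e4 : (h : ℝ) * (x - q) = h * -q + h * x := by ring
      rw [e1, e2, e3, e4]
      simp only [expChar_add]
      ring
  · rw [← Complex.ofReal_sub, ← Complex.ofReal_sub, ← Complex.ofReal_sub, ← Complex.ofReal_neg,
      ← Complex.ofReal_mul, ← Complex.ofReal_add]
    congr 1
    have hpi := Real.pi_ne_zero
    simp only [bump, smoothFloor, floorPrimitive_eq_fract]
    field_simp
    ring

/-- A bound for the Fourier coefficients of `bump (1 / H) p q`. -/
noncomputable def coeffBound (H : ℕ) (h : ℤ) : ℝ :=
  if h = 0 then 3 else 2 * (1 / (h.natAbs : ℝ) - 1 / ((h.natAbs : ℝ) + H))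

theorem coeffBound_nonneg (H : ℕ) (h : ℤ) : 0 ≤ coeffBound H h := by
  unfold coeffBound
  split_ifs with hh
  · norm_num
  · have : 0 < (h.natAbs : ℝ) := by exact_mod_cast Int.natAbs_pos.2 hh
    have : 1 / ((h.natAbs : ℝ) + H) ≤ 1 / (h.natAbs : ℝ) :=
      one_div_le_one_div_of_le this (by simp)
    linarith

/-- The factor `expChar (h * δ) - 1` is at most 2, which is the better bound for |h| > H, and at
most 2π|h|/H, which is better for small |h|. The form 2H/(|h|(|h| + H)) covers both ranges and has a
telescoping sum. -/
theorem norm_bumpCoeff_le {H : ℕ} (hH : 0 < H) {p q : ℝ} (hpq : |q - p| ≤ 3) (h : ℤ) :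
    ‖bumpCoeff (1 / H) p q h‖ ≤ coeffBound H h := by
  have hH' : (0 : ℝ) < H := by exact_mod_cast hH
  unfold bumpCoeff coeffBound
  split_ifs with hh
  · rwa [Complex.norm_real, Real.norm_eq_abs]
  · have ha : 0 < (h.natAbs : ℝ) := by exact_mod_cast Int.natAbs_pos.2 hh
    have habs : |(h : ℝ)| = h.natAbs := by rw [Nat.cast_natAbs, Int.cast_abs]
    set a : ℝ := (h.natAbs : ℝ) with ha'
    have n1 : ‖expChar (h * (1 / H)) - 1‖ ≤ 2 * Real.pi * (a / H) := by
      refine (norm_expChar_sub_one_le _).trans_eq ?_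
      rw [abs_mul, habs, abs_of_pos (by positivity : (0 : ℝ) < 1 / H)]; ring
    have n2 : ‖expChar (h * (1 / H)) - 1‖ ≤ 2 := by
      refine (norm_sub_le _ _).trans ?_
      rw [norm_expChar, norm_one]; norm_num
    have n3 : ‖expChar (h * -p) - expChar (h * -q)‖ ≤ 2 := by
      refine (norm_sub_le _ _).trans ?_
      rw [norm_expChar, norm_expChar]; norm_num
    have n4 : ‖(h : ℂ)‖ = a := by
      rw [Complex.norm_intCast, habs]
    rw [norm_mul, norm_mul, norm_mul, norm_neg, Complex.norm_real, norm_div (1 : ℂ), norm_one, norm_pow,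
      n4, Real.norm_eq_abs, abs_of_pos (by positivity)]
    have hpi := Real.pi_gt_three
    have hR : 2 * (1 / a - 1 / (a + H)) = 2 * H / (a * (a + H)) := by field_simp; ring
    rw [hR]
    set u := ‖expChar (h * (1 / H)) - 1‖
    set v := ‖expChar (h * -p) - expChar (h * -q)‖
    have hu : 0 ≤ u := norm_nonneg _
    have hv : 0 ≤ v := norm_nonneg _
    have key : u * v * (a + H) ≤ 8 * Real.pi ^ 2 * a := by
      have k1 : u * v ≤ u * 2 := by gcongr
      have k2 : u * (a + H) ≤ 2 * a + 2 * Real.pi * a := by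
        have : u * H ≤ 2 * Real.pi * a := by
          calc u * H ≤ 2 * Real.pi * (a / H) * H := by gcongr
            _ = _ := by field_simp
        nlinarith
      have k3 : u * v * (a + H) ≤ 2 * (u * (a + H)) := by
        calc u * v * (a + H) ≤ u * 2 * (a + H) := by gcongr
          _ = _ := by ring
      have : 4 * a + 4 * Real.pi * a ≤ 8 * Real.pi ^ 2 * a := by
        have : 4 + 4 * Real.pi ≤ 8 * Real.pi ^ 2 := by nlinarith
        nlinarith
      linarith
    rw [div_mul_div_comm, div_mul_eq_mul_div, div_le_div_iff₀ (by positivity) (by positivity)]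
    calc 1 * 1 * (u * v) * (a * (a + H)) = a * (u * v * (a + H)) := by ring
      _ ≤ a * (8 * Real.pi ^ 2 * a) := by gcongr
      _ = _ := by field_simp; ring

/-- The expression is symmetric in N and H, so it is at most the H-th harmonic number whatever N is.
-/
theorem sum_one_div_sub_le (H N : ℕ) :
    ∑ n ∈ Finset.range N, (1 / ((n : ℝ) + 1) - 1 / ((n : ℝ) + 1 + H)) ≤ 1 + Real.log H := by
  have h1 : ∑ n ∈ Finset.range N, (1 / ((n : ℝ) + 1) - 1 / ((n : ℝ) + 1 + H)) =
      ∑ n ∈ Finset.range H, (1 / ((n : ℝ) + 1) - 1 / ((n : ℝ) + 1 + N)) := by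
    have e1 := Finset.sum_range_add (fun n : ℕ => 1 / ((n : ℝ) + 1)) N H
    have e2 := Finset.sum_range_add (fun n : ℕ => 1 / ((n : ℝ) + 1)) H N
    rw [Finset.sum_sub_distrib, Finset.sum_sub_distrib]
    rw [add_comm H N, e1] at e2
    have f1 : ∑ n ∈ Finset.range N, 1 / ((n : ℝ) + 1 + H) =
        ∑ n ∈ Finset.range N, 1 / (((H + n : ℕ) : ℝ) + 1) :=
      Finset.sum_congr rfl fun n _ => by push_cast; ring_nf
    have f2 : ∑ n ∈ Finset.range H, 1 / ((n : ℝ) + 1 + N) =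
        ∑ n ∈ Finset.range H, 1 / (((N + n : ℕ) : ℝ) + 1) :=
      Finset.sum_congr rfl fun n _ => by push_cast; ring_nf
    rw [f1, f2]; linarith
  rw [h1]
  have h2 := harmonic_le_one_add_log H
  refine le_trans ?_ h2
  rw [harmonic]
  push_cast
  refine Finset.sum_le_sum fun n _ => ?_
  have : 0 ≤ 1 / ((n : ℝ) + 1 + N) := by positivity
  rw [← one_div]
  linarith

theorem summable_coeffBound (H : ℕ) :
    Summable (coeffBound H) ∧ ∑' h, coeffBound H h ≤ 7 + 4 * Real.log H := by
  set f : ℕ → ℝ := fun n => 1 / ((n : ℝ) + 1) - 1 / ((n : ℝ) + 1 + H) with hf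
  have hf0 : ∀ n, 0 ≤ f n := fun n => by
    have : 1 / ((n : ℝ) + 1 + H) ≤ 1 / ((n : ℝ) + 1) :=
      one_div_le_one_div_of_le (by positivity) (by simp)
    simp only [hf]; linarith
  have hs : Summable f := summable_of_sum_range_le hf0 (sum_one_div_sub_le H)
  have ht : ∑' n, f n ≤ 1 + Real.log H :=
    Real.tsum_le_of_sum_range_le hf0 (sum_one_div_sub_le H)
  have hp : ∀ n : ℕ, coeffBound H ((n : ℤ) + 1) = 2 * f n := by
    intro n
    rw [coeffBound, if_neg (by omega)]
    have : ((n : ℤ) + 1).natAbs = n + 1 := by omega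
    rw [this]; push_cast; rfl
  have hn : ∀ n : ℕ, coeffBound H (-((n : ℤ) + 1)) = 2 * f n := by
    intro n
    rw [coeffBound, if_neg (by omega)]
    have : (-((n : ℤ) + 1)).natAbs = n + 1 := by omega
    rw [this]; push_cast; rfl
  have := HasSum.of_add_one_of_neg_add_one (f := coeffBound H)
    (m := 2 * ∑' n, f n) (m' := 2 * ∑' n, f n)
    (by simp_rw [hp]; exact hs.hasSum.mul_left 2) (by simp_rw [hn]; exact hs.hasSum.mul_left 2)
  refine ⟨this.summable, ?_⟩
  rw [this.tsum_eq]
  have : coeffBound H 0 = 3 := by simp [coeffBound]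
  linarith

end CutProject

/-! ### A discrepancy inequality of Erdős–Turán type for linear forms -/

namespace CutProject

theorem hasSum_mul_prod {R ι κ : Type*} [NormedCommRing R] [CompleteSpace R] {f : ι → R}
    {g : κ → R} {a b : R} (hf : HasSum f a) (hg : HasSum g b) (hfn : Summable fun x => ‖f x‖)
    (hgn : Summable fun x => ‖g x‖) :
    HasSum (fun x : ι × κ => f x.1 * g x.2) (a * b) := by
  have h := summable_mul_of_summable_norm hfn hgn
  have h2 := hfn.of_norm.tsum_mul_tsum hgn.of_norm h
  rw [hf.tsum_eq, hg.tsum_eq] at h2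
  rw [h2]
  exact h.hasSum

theorem hasSum_prod_fin {R : Type*} [NormedCommRing R] [CompleteSpace R] {m : ℕ}
    {f : Fin m → ℤ → R} {a : Fin m → R} (hf : ∀ i, HasSum (f i) (a i))
    (hn : ∀ i, Summable fun h => ‖f i h‖) :
    HasSum (fun h : Fin m → ℤ => ∏ i, f i (h i)) (∏ i, a i) ∧
      Summable fun h : Fin m → ℤ => ‖∏ i, f i (h i)‖ := by
  induction m with
  | zero =>
    simp only [Finset.univ_eq_empty, Finset.prod_empty]
    exact ⟨by simp,
      (hasSum_fintype (fun _ : Fin 0 → ℤ => ‖(1 : R)‖)).summable⟩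
  | succ m ih =>
    obtain ⟨h1, h2⟩ := ih (f := fun i => f i.succ) (a := fun i => a i.succ)
      (fun i => hf i.succ) (fun i => hn i.succ)
    have h3 := hasSum_mul_prod (hf 0) h1 (hn 0) h2
    have h4 := Summable.mul_norm (f := f 0) (hn 0) h2
    let e : ℤ × (Fin m → ℤ) ≃ (Fin (m + 1) → ℤ) := Fin.consEquiv (fun _ => ℤ)
    have he : ∀ x : ℤ × (Fin m → ℤ),
        ∏ i, f i (e x i) = f 0 x.1 * ∏ i, f i.succ (x.2 i) := by
      intro x
      rw [Fin.prod_univ_succ]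
      rfl
    constructor
    · rw [← e.hasSum_iff, Fin.prod_univ_succ]
      simpa only [Function.comp_def, he] using h3
    · rw [← e.summable_iff]
      simpa only [Function.comp_def, he] using h4

/-- One factor is exchanged at a time; the constants satisfy 3(3ⁿ - 1) + 2 = 3ⁿ⁺¹ - 1. -/
theorem abs_prod_sub_prod_le {ι : Type*} (s : Finset ι) {x y : ι → ℝ} {δ : ℝ} (hδ : 0 ≤ δ)
    (hx : ∀ i, |x i| ≤ 3) (hy : ∀ i, |y i| ≤ 1) (hxy : ∀ i, |x i - y i| ≤ 2 * δ) :
    |∏ i ∈ s, x i - ∏ i ∈ s, y i| ≤ (3 ^ s.card - 1) * δ := by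
  classical
  induction s using Finset.induction_on with
  | empty => simp
  | insert a s ha ih =>
    rw [Finset.prod_insert ha, Finset.prod_insert ha, Finset.card_insert_of_notMem ha]
    have hP : |∏ i ∈ s, y i| ≤ 1 := by
      rw [Finset.abs_prod]
      exact Finset.prod_le_one (fun i _ => abs_nonneg _) fun i _ => hy i
    have e : x a * ∏ i ∈ s, x i - y a * ∏ i ∈ s, y i =
        x a * (∏ i ∈ s, x i - ∏ i ∈ s, y i) + (x a - y a) * ∏ i ∈ s, y i := by ring
    rw [e]
    refine (abs_add_le _ _).trans ?_
    rw [abs_mul, abs_mul]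
    have h1 : |x a| * |∏ i ∈ s, x i - ∏ i ∈ s, y i| ≤ 3 * ((3 ^ s.card - 1) * δ) := by
      gcongr
      exact hx a
    have h2 : |x a - y a| * |∏ i ∈ s, y i| ≤ 2 * δ * 1 := by
      gcongr
      exact hxy a
    rw [pow_succ]; linarith

/-- The integer interval `[-M, M]`. -/
noncomputable abbrev symmInterval (M : ℕ) : Finset ℤ := Finset.Icc (-(M : ℤ)) M

theorem card_symmInterval (M : ℕ) : (symmInterval M).card = 2 * M + 1 := by
  rw [Int.card_Icc]; omega

theorem expChar_mul_sum (M : ℕ) (θ : ℝ) :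
    (expChar θ - 1) * ∑ n ∈ symmInterval M, expChar (n * θ) =
      expChar ((M + 1) * θ) - expChar (-M * θ) := by
  have h : ∑ n ∈ symmInterval M, expChar (n * θ) =
      ∑ j ∈ Finset.range (2 * M + 1), expChar (((j : ℝ) - M) * θ) := by
    symm
    refine Finset.sum_nbij' (fun j : ℕ => (j : ℤ) - M) (fun n => (n + M).toNat) ?_ ?_ ?_ ?_ ?_
    · intro j hj; simp only [Finset.mem_range, symmInterval, Finset.mem_Icc] at *; omega
    · intro j hj; simp only [Finset.mem_range, symmInterval, Finset.mem_Icc] at *; omega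
    · intro j hj; simp
    · intro j hj; simp only [symmInterval, Finset.mem_Icc] at *; omega
    · intro j hj; push_cast; rfl
  rw [h, Finset.mul_sum]
  have : ∀ j ∈ Finset.range (2 * M + 1), (expChar θ - 1) * expChar (((j : ℝ) - M) * θ) =
      expChar ((((j + 1 : ℕ) : ℝ) - M) * θ) - expChar (((j : ℝ) - M) * θ) := by
    intro j _
    rw [sub_mul, one_mul, ← expChar_add]
    congr 2; push_cast; ring
  rw [Finset.sum_congr rfl this, Finset.sum_range_sub fun j : ℕ => expChar (((j : ℝ) - M) * θ)]
  congr 2 <;> push_cast <;> ring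

/-- A bound, up to a constant, for exponential sums of length `K`. -/
noncomputable def dirichletBound (K θ : ℝ) : ℝ := K / (1 + K * |θ - round θ|)

theorem dirichletBound_nonneg {K : ℝ} (hK : 0 ≤ K) (θ : ℝ) : 0 ≤ dirichletBound K θ := by
  unfold dirichletBound; positivity

theorem dirichletBound_mono {K K' : ℝ} (hK : 0 ≤ K) (h : K ≤ K') (θ : ℝ) :
    dirichletBound K θ ≤ dirichletBound K' θ := by
  unfold dirichletBound
  have hK' := hK.trans h
  have := abs_nonneg (θ - round θ)
  rw [div_le_div_iff₀ (by positivity) (by positivity)]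
  nlinarith [mul_nonneg hK (mul_nonneg hK' this)]

theorem four_mul_le_norm_expChar_sub_one (θ : ℝ) :
    4 * |θ - round θ| ≤ ‖expChar (-θ) - 1‖ := by
  have h1 : |Real.sin (Real.pi * -θ)| = |Real.sin (Real.pi * (θ - round θ))| := by
    rw [mul_neg, Real.sin_neg, abs_neg, mul_sub, mul_comm Real.pi (round θ : ℝ),
      Real.sin_sub_int_mul_pi, abs_mul]
    simp
  have h2 := abs_sub_round θ
  have hpi := Real.pi_pos
  have h3 := Real.mul_abs_le_abs_sin (x := Real.pi * (θ - round θ)) (by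
    rw [abs_mul, abs_of_pos hpi]; nlinarith)
  rw [abs_mul, abs_of_pos hpi] at h3
  rw [norm_expChar_sub_one, h1]
  have h4 : 2 / Real.pi * (Real.pi * |θ - round θ|) = 2 * |θ - round θ| := by field_simp
  linarith

/-- Combines the trivial bound ‖S‖ ≤ 2M + 1 with the geometric sum bound 4‖θ‖·‖S‖ ≤ 2, where ‖θ‖ is
the distance to the nearest integer. -/
theorem norm_sum_expChar_le (M : ℕ) (θ : ℝ) :
    ‖∑ n ∈ symmInterval M, expChar (n * -θ)‖ ≤ 2 * dirichletBound (2 * M + 1) θ := by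
  set S := ∑ n ∈ symmInterval M, expChar (n * -θ) with hS
  have h1 : ‖S‖ ≤ 2 * M + 1 := by
    refine (norm_sum_le _ _).trans_eq ?_
    simp only [norm_expChar, Finset.sum_const, card_symmInterval, nsmul_eq_mul]
    push_cast; ring
  have h2 : ‖expChar (-θ) - 1‖ * ‖S‖ ≤ 2 := by
    rw [← norm_mul, hS, expChar_mul_sum]
    refine (norm_sub_le _ _).trans ?_
    rw [norm_expChar, norm_expChar]; norm_num
  have h3 := four_mul_le_norm_expChar_sub_one θ
  have h4 : 4 * |θ - round θ| * ‖S‖ ≤ 2 :=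
    (mul_le_mul_of_nonneg_right h3 (norm_nonneg _)).trans h2
  unfold dirichletBound
  rw [← mul_div_assoc, le_div_iff₀ (by positivity)]
  have hM : (0 : ℝ) ≤ 2 * M + 1 := by positivity
  nlinarith

/-- The bound for the term with frequency vector `h` in the discrepancy estimate. -/
noncomputable def errTerm {d m : ℕ} (K : ℝ) (H : ℕ) (α : Fin m → Fin d → ℝ) (h : Fin m → ℤ) : ℝ :=
  (∏ i, coeffBound H (h i)) * ∏ j, dirichletBound K (∑ i, h i * α i j)

theorem errTerm_nonneg {d m : ℕ} {K : ℝ} (hK : 0 ≤ K) (H : ℕ) (α : Fin m → Fin d → ℝ)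
    (h : Fin m → ℤ) : 0 ≤ errTerm K H α h :=
  mul_nonneg (Finset.prod_nonneg fun _ _ => coeffBound_nonneg _ _)
    (Finset.prod_nonneg fun _ _ => dirichletBound_nonneg hK _)

theorem errTerm_mono {d m : ℕ} {K K' : ℝ} (hK : 0 ≤ K) (hKK' : K ≤ K') (H : ℕ)
    (α : Fin m → Fin d → ℝ) (h : Fin m → ℤ) : errTerm K H α h ≤ errTerm K' H α h :=
  mul_le_mul_of_nonneg_left
    (Finset.prod_le_prod (fun _ _ => dirichletBound_nonneg hK _)
      fun _ _ => dirichletBound_mono hK hKK' _)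
    (Finset.prod_nonneg fun _ _ => coeffBound_nonneg _ _)

/-- The integer points of the cube `[-M, M]^d`. -/
noncomputable abbrev intCube (d M : ℕ) : Finset (Fin d → ℤ) := Fintype.piFinset fun _ => symmInterval M

theorem card_intCube (d M : ℕ) : (intCube d M).card = (2 * M + 1) ^ d := by
  rw [Fintype.card_piFinset]; simp only [card_symmInterval, Finset.prod_const]; simp

/-- The phase is linear in n, so the sum over the cube splits into d one-dimensional geometric sums.
-/
theorem sum_prod_expChar {d m M : ℕ} (α : Fin m → Fin d → ℝ) (w : Fin m → ℝ) (c : Fin m → ℂ)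
    (h : Fin m → ℤ) :
    ∑ n ∈ intCube d M, ∏ i, c i * expChar (h i * (w i - ∑ j, α i j * n j)) =
      ((∏ i, c i) * expChar (∑ i, h i * w i)) *
        ∏ j, ∑ n ∈ symmInterval M, expChar (n * -∑ i, h i * α i j) := by
  rw [Finset.prod_univ_sum, Finset.mul_sum]
  refine Finset.sum_congr rfl fun n _ => ?_
  rw [Finset.prod_mul_distrib, ← expChar_sum, ← expChar_sum, mul_assoc, ← expChar_add]
  congr 2
  simp_rw [mul_sub, Finset.sum_sub_distrib, mul_neg, Finset.sum_neg_distrib, sub_eq_add_neg,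
    Finset.mul_sum]
  rw [Finset.sum_comm]
  congr 2
  exact Finset.sum_congr rfl fun _ _ => Finset.sum_congr rfl fun _ _ => by ring

/-- The zero frequency gives the main term, and `errTerm` bounds every other frequency up to the
factor 2^d. Bounding all finite partial sums by B makes a separate summability assumption
unnecessary. -/
theorem abs_sum_prod_bump_sub_le {d m H M : ℕ} (hH : 0 < H) {p q : Fin m → ℝ}
    (hpq : ∀ i, |q i - p i| ≤ 3) (w : Fin m → ℝ) (α : Fin m → Fin d → ℝ) {B : ℝ}
    (hB : ∀ s : Finset (Fin m → ℤ), 0 ∉ s → ∑ h ∈ s, errTerm (2 * M + 1) H α h ≤ B) :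
    |∑ n ∈ intCube d M, ∏ i, bump (1 / H) (p i) (q i) (w i - ∑ j, α i j * n j) -
      (2 * M + 1) ^ d * ∏ i, (q i - p i)| ≤ 2 ^ d * B := by
  have hH' : (0 : ℝ) < 1 / H := by
    have : (0 : ℝ) < H := by exact_mod_cast hH
    positivity
  set c : Fin m → ℤ → ℂ := fun i h => bumpCoeff (1 / H) (p i) (q i) h with hc
  have hcb : ∀ i h, ‖c i h‖ ≤ coeffBound H h := fun i h => norm_bumpCoeff_le hH (hpq i) h
  set E : (Fin m → ℤ) → ℂ := fun h =>
    ∑ n ∈ intCube d M, ∏ i, c i (h i) * expChar (h i * (w i - ∑ j, α i j * n j)) with hE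
  have hEsum : HasSum E
      (∑ n ∈ intCube d M, ∏ i, (bump (1 / H) (p i) (q i) (w i - ∑ j, α i j * n j) : ℂ)) := by
    refine hasSum_sum fun n _ => ?_
    refine (hasSum_prod_fin (fun i => hasSum_bumpCoeff hH' (p i) (q i) _) fun i => ?_).1
    refine Summable.of_nonneg_of_le (fun _ => norm_nonneg _) (fun h => ?_)
      (summable_coeffBound H).1
    rw [norm_mul, norm_expChar, mul_one]
    exact hcb i h
  have hEn : ∀ h, ‖E h‖ ≤ 2 ^ d * errTerm (2 * M + 1) H α h := by
    intro h
    rw [hE]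
    simp only
    rw [sum_prod_expChar α w (fun i => c i (h i)) h, norm_mul, norm_mul, norm_expChar, mul_one,
      norm_prod, norm_prod, errTerm]
    calc (∏ i, ‖c i (h i)‖) * ∏ j, ‖∑ n ∈ symmInterval M, expChar (n * -∑ i, h i * α i j)‖
        ≤ (∏ i, coeffBound H (h i)) *
          ∏ j, (2 * dirichletBound (2 * M + 1) (∑ i, h i * α i j)) := by
          refine mul_le_mul (Finset.prod_le_prod (fun _ _ => norm_nonneg _) fun i _ => hcb i _)
            (Finset.prod_le_prod (fun _ _ => norm_nonneg _) fun j _ => norm_sum_expChar_le M _)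
            (Finset.prod_nonneg fun _ _ => norm_nonneg _)
            (Finset.prod_nonneg fun _ _ => coeffBound_nonneg _ _)
      _ = _ := by
          rw [Finset.prod_mul_distrib]; simp; ring
  have hE0 : E 0 = (((2 * M + 1) ^ d * ∏ i, (q i - p i) : ℝ) : ℂ) := by
    simp only [hE, hc, bumpCoeff, Pi.zero_apply, Int.cast_zero, zero_mul, expChar_zero, mul_one,
      if_true, Finset.sum_const, card_intCube]
    push_cast; simp
  have hd := hEsum.sub (hasSum_ite_eq (0 : Fin m → ℤ) (E 0))
  have hlim : ‖(∑ n ∈ intCube d M,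
      ∏ i, (bump (1 / H) (p i) (q i) (w i - ∑ j, α i j * n j) : ℂ)) - E 0‖ ≤ 2 ^ d * B := by
    refine le_of_tendsto (Tendsto.norm hd) (Eventually.of_forall fun s => ?_)
    have e : ∑ h ∈ s, (E h - if h = 0 then E 0 else 0) = ∑ h ∈ s.erase 0, E h := by
      rw [← Finset.sum_erase s (a := (0 : Fin m → ℤ)) (by simp)]
      refine Finset.sum_congr rfl fun h hh => ?_
      rw [if_neg (Finset.ne_of_mem_erase hh), sub_zero]
    rw [e]
    calc ‖∑ h ∈ s.erase 0, E h‖ ≤ ∑ h ∈ s.erase 0, 2 ^ d * errTerm (2 * M + 1) H α h :=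
          norm_sum_le_of_le _ fun h _ => hEn h
      _ = 2 ^ d * ∑ h ∈ s.erase 0, errTerm (2 * M + 1) H α h := by rw [Finset.mul_sum]
      _ ≤ 2 ^ d * B := by
          gcongr
          exact hB _ (Finset.notMem_erase _ _)
  rw [hE0] at hlim
  have e : (∑ n ∈ intCube d M,
      ∏ i, (bump (1 / H) (p i) (q i) (w i - ∑ j, α i j * n j) : ℂ)) =
      ((∑ n ∈ intCube d M,
        ∏ i, bump (1 / H) (p i) (q i) (w i - ∑ j, α i j * n j) : ℝ) : ℂ) := by push_cast; rfl
  rwa [e, ← Complex.ofReal_sub, Complex.norm_real, Real.norm_eq_abs] at hlim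

/-- The discrepancy of the points `w - L n`, `n ∈ [-M, M]^d`, modulo `1` with respect to a box. -/
theorem abs_sum_indicator_sub_le {d m H M : ℕ} (hH : 0 < H) {a b : Fin m → ℝ}
    {J : Fin m → Set ℝ} (ha : ∀ i, 0 ≤ a i) (hab : ∀ i, a i ≤ b i) (hb : ∀ i, b i ≤ 1)
    (hJ : ∀ i, Set.Ioo (a i) (b i) ⊆ J i) (hJ' : ∀ i, J i ⊆ Set.Icc (a i) (b i))
    (w : Fin m → ℝ) (α : Fin m → Fin d → ℝ) {B : ℝ}
    (hB : ∀ s : Finset (Fin m → ℤ), 0 ∉ s → ∑ h ∈ s, errTerm (2 * M + 1) H α h ≤ B) :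
    |∑ n ∈ intCube d M, ∏ i, (J i).indicator (1 : ℝ → ℝ) (Int.fract (w i - ∑ j, α i j * n j)) -
      (2 * M + 1) ^ d * ∏ i, (b i - a i)| ≤ (2 * M + 1) ^ d * (3 ^ m / H) + 2 ^ d * B := by
  have hH1 : (1 : ℝ) ≤ H := by exact_mod_cast hH
  have hδ : (0 : ℝ) < 1 / H := by positivity
  have hδ1 : (1 : ℝ) / H ≤ 1 := by rw [div_le_one (by positivity)]; exact hH1
  have hN : (0 : ℝ) ≤ (2 * M + 1) ^ d := by positivity
  have hB0 : 0 ≤ B := by simpa using hB ∅ (by simp)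
  have h3 : (3 : ℝ) ^ m / H = 3 ^ m * (1 / H) := by ring
  have hy : ∀ i, |b i - a i| ≤ 1 := fun i => by
    rw [abs_le]; constructor <;> linarith [ha i, hb i, hab i]
  have hprod : ∀ p q : Fin m → ℝ, (∀ i, |q i - p i| ≤ 3) →
      (∀ i, |(q i - p i) - (b i - a i)| ≤ 2 * (1 / H)) →
      |∏ i, (q i - p i) - ∏ i, (b i - a i)| ≤ 3 ^ m * (1 / H) := by
    intro p q h1 h2
    refine (abs_prod_sub_prod_le Finset.univ hδ.le h1 hy h2).trans ?_
    rw [Finset.card_univ, Fintype.card_fin]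
    gcongr
    linarith
  rw [abs_le, h3]
  constructor
  -- The minorant's factors are nonnegative only if the side is at least 3/H, and nonnegativity is
  -- needed to compare products. If some side is shorter, the box has volume below 3/H and the lower
  -- bound is trivial.
  · by_cases hsmall : ∀ i, 3 * (1 / (H : ℝ)) ≤ b i - a i
    · have hpq : ∀ i, |b i - (a i + 2 * (1 / H))| ≤ 3 := fun i => by
        rw [abs_le]; constructor <;> linarith [ha i, hb i, hab i]
      have k1 := (abs_le.1 (abs_sum_prod_bump_sub_le hH hpq w α hB)).1
      have k2 := (abs_le.1 (hprod _ _ hpq fun i => by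
        rw [abs_le]; constructor <;> linarith)).1
      have k3 : ∑ n ∈ intCube d M,
          ∏ i, bump (1 / H) (a i + 2 * (1 / H)) (b i) (w i - ∑ j, α i j * n j) ≤
          ∑ n ∈ intCube d M, ∏ i, (J i).indicator (1 : ℝ → ℝ)
            (Int.fract (w i - ∑ j, α i j * n j)) := by
        refine Finset.sum_le_sum fun n _ => Finset.prod_le_prod (fun i _ => ?_) fun i _ => ?_
        · exact bump_nonneg hδ (by linarith [hsmall i]) _
        · exact bump_le_indicator hδ (ha i) (hb i) (hJ i) _
      have k4 := mul_le_mul_of_nonneg_left k2 hN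
      linarith
    · push Not at hsmall
      obtain ⟨i, hi⟩ := hsmall
      have k1 : ∏ i, (b i - a i) ≤ 3 ^ m * (1 / H) := by
        rw [← Finset.mul_prod_erase _ _ (Finset.mem_univ i)]
        have : ∏ j ∈ Finset.univ.erase i, (b j - a j) ≤ 1 :=
          Finset.prod_le_one (fun j _ => by linarith [hab j]) fun j _ =>
            (le_abs_self _).trans (hy j)
        have h0 : 0 ≤ ∏ j ∈ Finset.univ.erase i, (b j - a j) :=
          Finset.prod_nonneg (fun j _ => by linarith [hab j])
        have h3m : (3 : ℝ) ≤ 3 ^ m := by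
          have : m ≠ 0 := by rintro rfl; exact i.elim0
          exact le_self_pow₀ (by norm_num) this
        calc (b i - a i) * ∏ j ∈ Finset.univ.erase i, (b j - a j) ≤ (3 * (1 / H)) * 1 := by
              gcongr
          _ ≤ 3 ^ m * (1 / H) := by rw [mul_one]; gcongr
      have k3 : 0 ≤ ∑ n ∈ intCube d M, ∏ i, (J i).indicator (1 : ℝ → ℝ)
            (Int.fract (w i - ∑ j, α i j * n j)) :=
        Finset.sum_nonneg fun n _ => Finset.prod_nonneg fun i _ =>
          Set.indicator_nonneg (fun _ _ => zero_le_one) _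
      have k4 := mul_le_mul_of_nonneg_left k1 hN
      have : 0 ≤ 2 ^ d * B := by positivity
      linarith
  · have hpq : ∀ i, |b i + 2 * (1 / H) - a i| ≤ 3 := fun i => by
      rw [abs_le]; constructor <;> linarith [ha i, hb i, hab i]
    have k1 := (abs_le.1 (abs_sum_prod_bump_sub_le hH hpq w α hB)).2
    have k2 := (abs_le.1 (hprod a (fun i => b i + 2 * (1 / H)) hpq fun i => by
      rw [abs_le]; constructor <;> linarith)).2
    have k3 : ∑ n ∈ intCube d M, ∏ i, (J i).indicator (1 : ℝ → ℝ)
          (Int.fract (w i - ∑ j, α i j * n j)) ≤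
        ∑ n ∈ intCube d M,
          ∏ i, bump (1 / H) (a i) (b i + 2 * (1 / H)) (w i - ∑ j, α i j * n j) := by
      refine Finset.sum_le_sum fun n _ => Finset.prod_le_prod (fun i _ => ?_) fun i _ => ?_
      · exact Set.indicator_nonneg (fun _ _ => zero_le_one) _
      · exact indicator_le_bump hδ (hab i) (hJ' i) _
    have k4 := mul_le_mul_of_nonneg_left k2 hN
    linarith

end CutProject

/-! ### Averaging the error terms over the coefficients of L -/

namespace CutProject

theorem dirichletBound_eq (K θ : ℝ) :
    dirichletBound K θ = K / (1 + K * min (Int.fract θ) (1 - Int.fract θ)) := by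
  rw [dirichletBound, abs_sub_round_eq_min]

theorem dirichletBound_periodic (K : ℝ) : Function.Periodic (dirichletBound K) 1 := by
  intro x
  rw [dirichletBound_eq, dirichletBound_eq, Int.fract_add_one]

theorem measurable_dirichletBound (K : ℝ) : Measurable (dirichletBound K) := by
  have : dirichletBound K = fun θ => K / (1 + K * min (Int.fract θ) (1 - Int.fract θ)) :=
    funext (dirichletBound_eq K)
  rw [this]
  have := measurable_fract (R := ℝ)
  fun_prop

theorem dirichletBound_le {K : ℝ} (hK : 0 ≤ K) (θ : ℝ) : dirichletBound K θ ≤ K :=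
  div_le_self hK (le_add_of_nonneg_right (by positivity))

theorem integrable_dirichletBound_comp {K : ℝ} (hK : 0 ≤ K) {X : Type*} [MeasurableSpace X]
    {μ : Measure X} [IsFiniteMeasure μ] {f : X → ℝ} (hf : Measurable f) :
    Integrable (fun x => dirichletBound K (f x)) μ := by
  refine Integrable.of_bound ((measurable_dirichletBound K).comp hf).aestronglyMeasurable K
    (Eventually.of_forall fun x => ?_)
  rw [Real.norm_eq_abs, abs_of_nonneg (dirichletBound_nonneg hK _)]
  exact dirichletBound_le hK _

theorem intervalIntegrable_dirichletBound {K : ℝ} (hK : 0 ≤ K) (a b : ℝ) :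
    IntervalIntegrable (dirichletBound K) volume a b :=
  ⟨integrable_dirichletBound_comp hK measurable_id, integrable_dirichletBound_comp hK measurable_id⟩

theorem integral_dirichletBound_le {K : ℝ} (hK : 0 ≤ K) :
    ∫ u in (0 : ℝ)..1, dirichletBound K u ≤ 2 * Real.log (1 + K) := by
  have hd1 : ∀ u ∈ Set.uIcc (0 : ℝ) 1,
      HasDerivAt (fun u => Real.log (1 + K * u)) (K / (1 + K * u)) u := by
    intro u hu
    rw [Set.uIcc_of_le zero_le_one] at hu
    have hpos : 0 < 1 + K * u := by have := mul_nonneg hK hu.1; linarith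
    have := (((hasDerivAt_id u).const_mul K).const_add 1).log hpos.ne'
    simpa using this
  have hd2 : ∀ u ∈ Set.uIcc (0 : ℝ) 1,
      HasDerivAt (fun u => -Real.log (1 + K * (1 - u))) (K / (1 + K * (1 - u))) u := by
    intro u hu
    rw [Set.uIcc_of_le zero_le_one] at hu
    have hpos : 0 < 1 + K * (1 - u) := by
      have := mul_nonneg hK (sub_nonneg.2 hu.2); linarith
    have := (((((hasDerivAt_id u).const_sub 1).const_mul K).const_add 1).log hpos.ne').neg
    refine HasDerivAt.congr_deriv this ?_
    simp [neg_div]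
  have hc1 : ContinuousOn (fun u => K / (1 + K * u)) (Set.uIcc (0 : ℝ) 1) := by
    refine ContinuousOn.div (by fun_prop) (by fun_prop) fun u hu => ?_
    rw [Set.uIcc_of_le zero_le_one] at hu
    have := mul_nonneg hK hu.1
    positivity
  have hc2 : ContinuousOn (fun u => K / (1 + K * (1 - u))) (Set.uIcc (0 : ℝ) 1) := by
    refine ContinuousOn.div (by fun_prop) (by fun_prop) fun u hu => ?_
    rw [Set.uIcc_of_le zero_le_one] at hu
    have := mul_nonneg hK (sub_nonneg.2 hu.2)
    positivity
  have i1 := intervalIntegral.integral_eq_sub_of_hasDerivAt hd1 hc1.intervalIntegrable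
  have i2 := intervalIntegral.integral_eq_sub_of_hasDerivAt hd2 hc2.intervalIntegrable
  calc ∫ u in (0 : ℝ)..1, dirichletBound K u
      ≤ ∫ u in (0 : ℝ)..1, (K / (1 + K * u) + K / (1 + K * (1 - u))) := by
        -- The distance to the nearest integer is u or 1 - u, so the integrand is at most the sum of
        -- both alternatives.
        refine intervalIntegral.integral_mono_on_of_le_Ioo zero_le_one
          (intervalIntegrable_dirichletBound hK 0 1)
          (hc1.intervalIntegrable.add hc2.intervalIntegrable) fun u hu => ?_
        have hf : Int.fract u = u := Int.fract_eq_self.2 ⟨hu.1.le, hu.2⟩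
        have h1 := mul_nonneg hK hu.1.le
        have h2 := mul_nonneg hK (sub_nonneg.2 hu.2.le)
        have p1 : 0 ≤ K / (1 + K * u) := by positivity
        have p2 : 0 ≤ K / (1 + K * (1 - u)) := by positivity
        rw [dirichletBound_eq, hf]
        rcases min_choice u (1 - u) with h | h <;> rw [h] <;> linarith
    _ = _ := by
        rw [intervalIntegral.integral_add hc1.intervalIntegrable hc2.intervalIntegrable, i1, i2]
        simp; ring

/-- For integers h and L the argument runs over 2|h|L full periods, so the integral is 2L times that
over one period, for every h ≠ 0 and c. -/
theorem integral_dirichletBound_comp_le {K : ℝ} (hK : 0 ≤ K) (L : ℕ) {h : ℤ} (hh : h ≠ 0)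
    (c : ℝ) :
    ∫ x in Set.Ioc (-(L : ℝ)) L, dirichletBound K (h * x + c) ≤ 4 * L * Real.log (1 + K) := by
  have hh' : (h : ℝ) ≠ 0 := by exact_mod_cast hh
  rw [← intervalIntegral.integral_of_le (by linarith [(Nat.cast_nonneg L : (0 : ℝ) ≤ L)]),
    intervalIntegral.integral_comp_mul_add _ hh']
  have e : (h : ℝ) * L + c = h * -L + c + (2 * h * L : ℤ) • (1 : ℝ) := by
    simp; ring
  rw [e, (dirichletBound_periodic K).intervalIntegral_add_zsmul_eq _ _
    (intervalIntegrable_dirichletBound hK),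
    (dirichletBound_periodic K).intervalIntegral_add_eq _ 0, zero_add]
  have := integral_dirichletBound_le hK
  have hL : (0 : ℝ) ≤ 2 * L := by positivity
  calc (h : ℝ)⁻¹ • (2 * h * L : ℤ) • ∫ u in (0 : ℝ)..1, dirichletBound K u
      = 2 * L * ∫ u in (0 : ℝ)..1, dirichletBound K u := by
        simp; field_simp
    _ ≤ 2 * L * (2 * Real.log (1 + K)) := by gcongr
    _ = _ := by ring

/-- Lebesgue measure on `(-L, L]`. -/
noncomputable abbrev boxMeasure (L : ℕ) : Measure ℝ := volume.restrict (Set.Ioc (-(L : ℝ)) L)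

theorem lintegral_prod_dirichletBound_le {d : ℕ} {K : ℝ} (hK : 0 ≤ K) (L : ℕ) {h : ℤ}
    (hh : h ≠ 0) (c : Fin d → ℝ) :
    ∫⁻ x, ENNReal.ofReal (∏ j, dirichletBound K (h * x j + c j))
        ∂(Measure.pi fun _ : Fin d => boxMeasure L) ≤
      ENNReal.ofReal ((4 * L * Real.log (1 + K)) ^ d) := by
  have hF : ∀ j, Measurable fun x : Fin d → ℝ => dirichletBound K (h * x j + c j) := fun j =>
    (measurable_dirichletBound K).comp (by fun_prop)
  have hint : Integrable (fun x : Fin d → ℝ => ∏ j, dirichletBound K (h * x j + c j))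
      (Measure.pi fun _ : Fin d => boxMeasure L) := by
    refine Integrable.of_bound
      (Finset.measurable_prod _ fun j _ => hF j).aestronglyMeasurable (K ^ d)
      (Eventually.of_forall fun x => ?_)
    rw [Real.norm_eq_abs, abs_of_nonneg (Finset.prod_nonneg fun _ _ => dirichletBound_nonneg hK _)]
    refine (Finset.prod_le_prod (fun _ _ => dirichletBound_nonneg hK _)
      fun _ _ => dirichletBound_le hK _).trans_eq ?_
    simp
  rw [← ofReal_integral_eq_lintegral_ofReal hint (Eventually.of_forall fun x =>
    Finset.prod_nonneg fun _ _ => dirichletBound_nonneg hK _)]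
  refine ENNReal.ofReal_le_ofReal ?_
  rw [integral_fintype_prod_eq_prod (fun j x => dirichletBound K (h * x + c j))]
  refine (Finset.prod_le_prod (fun _ _ => integral_nonneg fun _ => dirichletBound_nonneg hK _)
    fun j _ => integral_dirichletBound_comp_le hK L hh (c j)).trans_eq ?_
  simp

/-- Lebesgue measure on the matrices with entries in `(-L, L]`. -/
noncomputable abbrev matMeasure (m d L : ℕ) : Measure (Fin m → Fin d → ℝ) :=
  Measure.pi fun _ => Measure.pi fun _ => boxMeasure L

theorem measurable_errTerm {d m : ℕ} (K : ℝ) (H : ℕ) (h : Fin m → ℤ) :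
    Measurable fun α : Fin m → Fin d → ℝ => errTerm K H α h := by
  unfold errTerm
  refine Measurable.const_mul (Finset.measurable_prod _ fun j _ => ?_) _
  exact (measurable_dirichletBound K).comp (by fun_prop)

/-- Choose a row i₀ with h i₀ ≠ 0 and freeze the other rows. The d factors then involve distinct
entries of row i₀, so the integral is a product. The other m - 1 rows contribute only their volume.
-/
theorem lintegral_errTerm_le {d m : ℕ} {K : ℝ} (hK : 0 ≤ K) (H L : ℕ) {h : Fin m → ℤ}
    (hh : h ≠ 0) :
    ∫⁻ α, ENNReal.ofReal (errTerm K H α h) ∂matMeasure m d L ≤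
      ENNReal.ofReal (∏ i, coeffBound H (h i)) *
        ENNReal.ofReal ((4 * L * Real.log (1 + K)) ^ d) *
        (ENNReal.ofReal (2 * L) ^ d) ^ (m - 1) := by
  obtain ⟨i₀, hi₀⟩ := Function.ne_iff.1 hh
  obtain ⟨n, rfl⟩ : ∃ n, m = n + 1 := ⟨m - 1, by have := i₀.pos; omega⟩
  let ν : Measure (Fin d → ℝ) := Measure.pi fun _ => boxMeasure L
  have hν : ν Set.univ = ENNReal.ofReal (2 * L) ^ d := by
    simp only [ν, Measure.pi_univ, Measure.restrict_apply_univ, Real.volume_Ioc,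
      Finset.prod_const, Finset.card_univ, Fintype.card_fin]
    congr 2; ring
  let e := MeasurableEquiv.piFinSuccAbove (fun _ : Fin (n + 1) => Fin d → ℝ) i₀
  have mp := (measurePreserving_piFinSuccAbove (fun _ : Fin (n + 1) => ν) i₀).symm
  rw [← mp.lintegral_comp_emb e.symm.measurableEmbedding, lintegral_prod_symm]
  swap
  · exact (((measurable_errTerm K H h).comp e.symm.measurable).ennreal_ofReal).aemeasurable
  have inner : ∀ y : Fin n → Fin d → ℝ,
      ∫⁻ x, ENNReal.ofReal (errTerm K H (e.symm (x, y)) h) ∂ν ≤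
        ENNReal.ofReal (∏ i, coeffBound H (h i)) *
          ENNReal.ofReal ((4 * L * Real.log (1 + K)) ^ d) := by
    intro y
    have he : ∀ x, errTerm K H (e.symm (x, y)) h = (∏ i, coeffBound H (h i)) *
        ∏ j, dirichletBound K (h i₀ * x j + ∑ i, h (i₀.succAbove i) * y i j) := by
      intro x
      rw [errTerm]
      congr 1
      refine Finset.prod_congr rfl fun j _ => ?_
      rw [Fin.sum_univ_succAbove _ i₀]
      simp [e, MeasurableEquiv.piFinSuccAbove_symm_apply, Fin.insertNthEquiv]
    simp_rw [he, ENNReal.ofReal_mul (Finset.prod_nonneg fun i _ => coeffBound_nonneg H (h i))]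
    rw [lintegral_const_mul' _ _ ENNReal.ofReal_ne_top]
    gcongr
    exact lintegral_prod_dirichletBound_le hK L hi₀ _
  refine (lintegral_mono inner).trans_eq ?_
  rw [lintegral_const, Measure.pi_univ]
  simp [hν]

theorem lintegral_tsum_errTerm_le {d m : ℕ} {K : ℝ} (hK : 0 ≤ K) (H L : ℕ) :
    ∫⁻ α, ∑' h : Fin m → ℤ, (if h = 0 then 0 else ENNReal.ofReal (errTerm K H α h))
        ∂matMeasure m d L ≤
      ENNReal.ofReal ((7 + 4 * Real.log H) ^ m) *
        ENNReal.ofReal ((4 * L * Real.log (1 + K)) ^ d) *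
        (ENNReal.ofReal (2 * L) ^ d) ^ (m - 1) := by
  rw [lintegral_tsum]
  swap
  · intro h
    split_ifs
    · exact aemeasurable_const
    · exact (measurable_errTerm K H h).ennreal_ofReal.aemeasurable
  obtain ⟨hs, ht⟩ := summable_coeffBound H
  have hs' : Summable fun h => ‖coeffBound H h‖ := hs.norm
  have hp := (hasSum_prod_fin (m := m) (fun _ => hs.hasSum) fun _ => hs').1
  calc _ ≤ ∑' h : Fin m → ℤ, ENNReal.ofReal (∏ i, coeffBound H (h i)) *
        (ENNReal.ofReal ((4 * L * Real.log (1 + K)) ^ d) *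
        (ENNReal.ofReal (2 * L) ^ d) ^ (m - 1)) := by
        refine ENNReal.tsum_le_tsum fun h => ?_
        split_ifs with hh
        · simp
        · rw [← mul_assoc]
          exact lintegral_errTerm_le hK H L hh
    _ ≤ _ := by
        rw [ENNReal.tsum_mul_right, ← ENNReal.ofReal_tsum_of_nonneg
          (fun h => Finset.prod_nonneg fun i _ => coeffBound_nonneg H (h i)) hp.summable,
          hp.tsum_eq, ← mul_assoc]
        gcongr
        simp only [Finset.prod_const, Finset.card_univ, Fintype.card_fin]
        exact pow_le_pow_left₀ (tsum_nonneg (coeffBound_nonneg H)) ht m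

end CutProject

/-! ### Discrepancy bound for almost every L -/

namespace CutProject

/-- At scale M = 2^(2^i) with H = M^d, the logarithms of K and H are O(2^i), so the average is
O((2^i)^(d+m)). -/
theorem lintegral_tsum_errTerm_dyadic_le (d m L i : ℕ) :
    ∫⁻ α, ∑' h : Fin m → ℤ, (if h = 0 then 0 else
        ENNReal.ofReal (errTerm (2 * ((2 ^ 2 ^ i : ℕ) : ℝ) + 1) ((2 ^ 2 ^ i) ^ d) α h))
        ∂matMeasure m d L ≤
      ENNReal.ofReal ((7 + 4 * d) ^ m) * ENNReal.ofReal ((12 * L) ^ d) *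
        (ENNReal.ofReal (2 * L) ^ d) ^ (m - 1) * ENNReal.ofReal (((2 : ℝ) ^ i) ^ (d + m)) := by
  have hl2 : Real.log 2 ≤ 1 := by linarith [Real.log_two_lt_d9]
  have hl2' := Real.log_nonneg (one_le_two (α := ℝ))
  have h2i : (1 : ℝ) ≤ 2 ^ i := one_le_pow₀ one_le_two
  have h1 : 7 + 4 * Real.log (((2 ^ 2 ^ i) ^ d : ℕ) : ℝ) ≤ (7 + 4 * d) * 2 ^ i := by
    push_cast
    rw [Real.log_pow, Real.log_pow]
    push_cast
    have : (d : ℝ) * (2 ^ i * Real.log 2) ≤ d * (2 ^ i * 1) := by gcongr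
    nlinarith
  have h2 : Real.log (1 + (2 * ((2 ^ 2 ^ i : ℕ) : ℝ) + 1)) ≤ 3 * 2 ^ i := by
    have hM : (1 : ℝ) ≤ ((2 ^ 2 ^ i : ℕ) : ℝ) := by exact_mod_cast Nat.one_le_two_pow
    calc Real.log (1 + (2 * ((2 ^ 2 ^ i : ℕ) : ℝ) + 1))
        ≤ Real.log (2 ^ 2 * ((2 ^ 2 ^ i : ℕ) : ℝ)) :=
          Real.log_le_log (by positivity) (by linarith)
      _ = (2 + 2 ^ i) * Real.log 2 := by
          rw [Real.log_mul (by norm_num) (by positivity)]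
          push_cast
          rw [Real.log_pow, Real.log_pow]; push_cast; ring
      _ ≤ (2 + 2 ^ i) * 1 := by gcongr
      _ ≤ _ := by linarith
  have h3 : 0 ≤ 7 + 4 * Real.log (((2 ^ 2 ^ i) ^ d : ℕ) : ℝ) := by
    have := Real.log_natCast_nonneg ((2 ^ 2 ^ i) ^ d)
    positivity
  have h4 : 0 ≤ Real.log (1 + (2 * ((2 ^ 2 ^ i : ℕ) : ℝ) + 1)) :=
    Real.log_nonneg (by linarith [(Nat.cast_nonneg (2 ^ 2 ^ i) : (0 : ℝ) ≤ _)])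
  refine (lintegral_tsum_errTerm_le (by positivity) _ L).trans ?_
  calc _ ≤ ENNReal.ofReal (((7 + 4 * d) * 2 ^ i) ^ m) *
        ENNReal.ofReal ((4 * L * (3 * 2 ^ i)) ^ d) * (ENNReal.ofReal (2 * L) ^ d) ^ (m - 1) := by
        gcongr
    _ = _ := by
        have e1 : ((7 + 4 * (d : ℝ)) * 2 ^ i) ^ m = (7 + 4 * d) ^ m * ((2 : ℝ) ^ i) ^ m :=
          mul_pow _ _ _
        have e2 : (4 * (L : ℝ) * (3 * 2 ^ i)) ^ d = (12 * L) ^ d * ((2 : ℝ) ^ i) ^ d := by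
          rw [← mul_pow]; ring
        rw [e1, e2, pow_add, ENNReal.ofReal_mul (by positivity), ENNReal.ofReal_mul (by positivity),
          ENNReal.ofReal_mul (p := ((2 : ℝ) ^ i) ^ d) (by positivity)]
        ring

/-- With weights (2^i)^(-(d+m+ε)) the averages are dominated by a geometric series of ratio 2^(-ε).
The weighted sum is therefore finite almost everywhere, and its value serves as B at all scales. -/
theorem ae_matMeasure_errTerm_le (d m L : ℕ) {ε : ℝ} (hε : 0 < ε) :
    ∀ᵐ α ∂matMeasure m d L, ∃ B : ℝ, ∀ i : ℕ, ∀ s : Finset (Fin m → ℤ), 0 ∉ s →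
      ∑ h ∈ s, errTerm (2 * ((2 ^ 2 ^ i : ℕ) : ℝ) + 1) ((2 ^ 2 ^ i) ^ d) α h ≤
        B * ((2 : ℝ) ^ i) ^ ((d : ℝ) + m + ε) := by
  set T : ℕ → (Fin m → Fin d → ℝ) → ENNReal := fun i α => ∑' h : Fin m → ℤ,
    (if h = 0 then 0 else
      ENNReal.ofReal (errTerm (2 * ((2 ^ 2 ^ i : ℕ) : ℝ) + 1) ((2 ^ 2 ^ i) ^ d) α h)) with hT
  have hTm : ∀ i, Measurable (T i) := by
    intro i
    refine Measurable.tsum fun h => ?_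
    split_ifs
    · exact measurable_const
    · exact (measurable_errTerm _ _ h).ennreal_ofReal
  set c : ℕ → ℝ := fun i => (((2 : ℝ) ^ i) ^ ((d : ℝ) + m + ε))⁻¹ with hc
  have hc0 : ∀ i, 0 < c i := fun i => by positivity
  set A : ENNReal := ENNReal.ofReal ((7 + 4 * d) ^ m) * ENNReal.ofReal ((12 * L) ^ d) *
    (ENNReal.ofReal (2 * L) ^ d) ^ (m - 1) with hA
  have hA' : A ≠ ⊤ := by
    rw [hA]
    refine ENNReal.mul_ne_top (ENNReal.mul_ne_top ENNReal.ofReal_ne_top ENNReal.ofReal_ne_top) ?_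
    exact ENNReal.pow_ne_top (ENNReal.pow_ne_top ENNReal.ofReal_ne_top)
  have hr : ∀ i : ℕ, ((2 : ℝ) ^ i) ^ (d + m) * c i = ((2 : ℝ) ^ (-ε)) ^ i := by
    intro i
    have h1 : ((2 : ℝ) ^ i) ^ ((d : ℝ) + m + ε) = ((2 : ℝ) ^ i) ^ (d + m) * ((2 : ℝ) ^ ε) ^ i := by
      rw [Real.rpow_add (by positivity), ← Nat.cast_add, Real.rpow_natCast, ← Real.rpow_natCast,
        ← Real.rpow_natCast, ← Real.rpow_natCast, ← Real.rpow_mul (by norm_num),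
        ← Real.rpow_mul (by norm_num), ← Real.rpow_mul (by norm_num), mul_comm ε]
    simp only [hc]
    rw [h1, Real.rpow_neg (by norm_num), inv_pow]
    field_simp
  have hr1 : (2 : ℝ) ^ (-ε) < 1 := Real.rpow_lt_one_of_one_lt_of_neg (by norm_num) (by linarith)
  have hint : ∫⁻ α, ∑' i, ENNReal.ofReal (c i) * T i α ∂matMeasure m d L ≠ ⊤ := by
    rw [lintegral_tsum fun i => ((hTm i).const_mul _).aemeasurable]
    have hle : ∀ i, ∫⁻ α, ENNReal.ofReal (c i) * T i α ∂matMeasure m d L ≤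
        A * ENNReal.ofReal ((2 : ℝ) ^ (-ε)) ^ i := by
      intro i
      rw [lintegral_const_mul _ (hTm i), ← ENNReal.ofReal_pow (by positivity), ← hr i,
        ENNReal.ofReal_mul (by positivity), mul_comm (ENNReal.ofReal (c i)), ← mul_assoc]
      gcongr
      exact lintegral_tsum_errTerm_dyadic_le d m L i
    refine ne_top_of_le_ne_top ?_ (ENNReal.tsum_le_tsum hle)
    rw [ENNReal.tsum_mul_left, ENNReal.tsum_geometric]
    refine ENNReal.mul_ne_top hA' (ENNReal.inv_ne_top.2 ?_)
    exact (tsub_pos_of_lt (ENNReal.ofReal_lt_one.2 hr1)).ne'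
  filter_upwards [ae_lt_top (Measurable.tsum fun i => (hTm i).const_mul _) hint] with α hα
  refine ⟨(∑' i, ENNReal.ofReal (c i) * T i α).toReal, fun i s hs => ?_⟩
  set V := ∑' i, ENNReal.ofReal (c i) * T i α
  set K : ℝ := 2 * ((2 ^ 2 ^ i : ℕ) : ℝ) + 1
  have hK : 0 ≤ K := by positivity
  have h1 : ENNReal.ofReal (∑ h ∈ s, errTerm K ((2 ^ 2 ^ i) ^ d) α h) ≤ T i α := by
    rw [ENNReal.ofReal_sum_of_nonneg fun h _ => errTerm_nonneg hK _ α h]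
    refine le_trans (le_of_eq ?_) (ENNReal.sum_le_tsum s)
    refine Finset.sum_congr rfl fun h hh => ?_
    rw [if_neg (by rintro rfl; exact hs hh)]
  have h2 : ENNReal.ofReal (c i) * T i α ≤ V :=
    ENNReal.le_tsum (f := fun i => ENNReal.ofReal (c i) * T i α) i
  have h3 : ENNReal.ofReal (c i * ∑ h ∈ s, errTerm K ((2 ^ 2 ^ i) ^ d) α h) ≤ V := by
    rw [ENNReal.ofReal_mul (hc0 i).le]
    exact le_trans (by gcongr) h2
  have h4 := (ENNReal.ofReal_le_iff_le_toReal hα.ne).1 h3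
  have h5 : ((2 : ℝ) ^ i) ^ ((d : ℝ) + m + ε) = (c i)⁻¹ := by simp [hc]
  rw [h5, ← div_eq_mul_inv, le_div_iff₀ (hc0 i), mul_comm]
  exact h4

theorem iUnion_box_eq_univ (m d : ℕ) :
    ⋃ L : ℕ, (Set.univ.pi fun _ : Fin m => Set.univ.pi fun _ : Fin d =>
      Set.Ioc (-(L : ℝ)) L) = Set.univ := by
  refine Set.eq_univ_of_forall fun α => Set.mem_iUnion.2 ?_
  obtain ⟨L, hL⟩ := exists_nat_gt ‖α‖
  refine ⟨L, fun i _ j _ => ?_⟩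
  have h : |α i j| < L := by
    have h1 := norm_le_pi_norm (α i) j
    have h2 := norm_le_pi_norm α i
    rw [Real.norm_eq_abs] at h1
    linarith
  exact ⟨(abs_lt.1 h).1, (abs_lt.1 h).2.le⟩

theorem ae_errTerm_le (d m : ℕ) {ε : ℝ} (hε : 0 < ε) :
    ∀ᵐ α : Fin m → Fin d → ℝ, ∃ B : ℝ, ∀ i : ℕ, ∀ s : Finset (Fin m → ℤ), 0 ∉ s →
      ∑ h ∈ s, errTerm (2 * ((2 ^ 2 ^ i : ℕ) : ℝ) + 1) ((2 ^ 2 ^ i) ^ d) α h ≤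
        B * ((2 : ℝ) ^ i) ^ ((d : ℝ) + m + ε) := by
  rw [← Measure.restrict_univ (μ := volume), ← iUnion_box_eq_univ m d, ae_restrict_iUnion_iff]
  intro L
  have e : (volume : Measure (Fin m → Fin d → ℝ)).restrict (Set.univ.pi fun _ : Fin m =>
      Set.univ.pi fun _ : Fin d => Set.Ioc (-(L : ℝ)) L) = matMeasure m d L := by
    rw [volume_pi, Measure.restrict_pi_pi]
    congr 1
    funext _
    rw [volume_pi, Measure.restrict_pi_pi]
  rw [e]
  exact ae_matMeasure_errTerm_le d m L hε

/-- Rounding R up to the next double power of 2 at most squares it (R ≥ 2), so the logarithm grows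
only by a bounded factor. These sparse scales thus suffice for all R. -/
theorem exists_le_two_pow_two_pow {R : ℝ} (hR : 2 ≤ R) :
    ∃ i : ℕ, R ≤ ((2 ^ 2 ^ i : ℕ) : ℝ) ∧ (2 : ℝ) ^ i ≤ 2 / Real.log 2 * Real.log R := by
  have hl2 := Real.log_pos (one_lt_two (α := ℝ))
  have hlR : Real.log 2 ≤ Real.log R := Real.log_le_log (by norm_num) hR
  have hex : ∃ i : ℕ, R ≤ ((2 ^ 2 ^ i : ℕ) : ℝ) := by
    obtain ⟨n, hn⟩ := exists_nat_gt R
    refine ⟨n, hn.le.trans ?_⟩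
    exact_mod_cast (Nat.lt_two_pow_self.trans Nat.lt_two_pow_self).le
  classical
  refine ⟨Nat.find hex, Nat.find_spec hex, ?_⟩
  rcases Nat.eq_zero_or_pos (Nat.find hex) with h | h
  · rw [h, pow_zero, div_mul_eq_mul_div, le_div_iff₀ hl2]; linarith
  · obtain ⟨j, hj⟩ : ∃ j, Nat.find hex = j + 1 := ⟨Nat.find hex - 1, by omega⟩
    have h1 := Nat.find_min hex (m := j) (by omega)
    push Not at h1
    have h2 := Real.log_le_log (by positivity) h1.le
    push_cast at h2
    rw [Real.log_pow] at h2
    push_cast at h2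
    rw [hj, pow_succ, div_mul_eq_mul_div, le_div_iff₀ hl2]
    linarith

/-- The number of `n ∈ [-R, R]^d` for which `w - L n` is congruent modulo `1` to an element
of a box deviates from the expected number by at most a power of `log R`. -/
def HasSmallDiscrepancy {d m : ℕ} (α : Fin m → Fin d → ℝ) (p C : ℝ) : Prop :=
  ∀ R : ℝ, 2 ≤ R → ∀ (w a b : Fin m → ℝ) (J : Fin m → Set ℝ),
    (∀ i, 0 ≤ a i) → (∀ i, a i ≤ b i) → (∀ i, b i ≤ 1) →
    (∀ i, Set.Ioo (a i) (b i) ⊆ J i) → (∀ i, J i ⊆ Set.Icc (a i) (b i)) →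
    |∑ n ∈ intCube d ⌊R⌋₊,
        ∏ i, (J i).indicator (1 : ℝ → ℝ) (Int.fract (w i - ∑ j, α i j * n j)) -
      (2 * (⌊R⌋₊ : ℝ) + 1) ^ d * ∏ i, (b i - a i)| ≤ C * Real.log R ^ p

theorem ae_hasSmallDiscrepancy (d m : ℕ) {ε : ℝ} (hε : 0 < ε) :
    ∀ᵐ α : Fin m → Fin d → ℝ, ∃ C : ℝ, 0 < C ∧ HasSmallDiscrepancy α ((d : ℝ) + m + ε) C := by
  filter_upwards [ae_errTerm_le d m hε] with α hα
  obtain ⟨B, hB⟩ := hα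
  set p : ℝ := (d : ℝ) + m + ε with hp
  have hp0 : 0 < p := by positivity
  have hl2 := Real.log_pos (one_lt_two (α := ℝ))
  set C₁ : ℝ := 3 ^ d * 3 ^ m * (Real.log 2 ^ p)⁻¹ with hC₁
  set C₂ : ℝ := 2 ^ d * (|B| * (2 / Real.log 2) ^ p) with hC₂
  refine ⟨C₁ + C₂, by positivity, ?_⟩
  intro R hR w a b J ha hab hb hJ hJ'
  have hlR : Real.log 2 ≤ Real.log R := Real.log_le_log (by norm_num) hR
  obtain ⟨i, hi1, hi2⟩ := exists_le_two_pow_two_pow hR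
  set M := ⌊R⌋₊ with hM
  set M' := 2 ^ 2 ^ i with hM'
  have hMM' : (M : ℝ) ≤ (M' : ℝ) := (Nat.floor_le (by linarith)).trans hi1
  have hM'1 : (1 : ℝ) ≤ (M' : ℝ) := by exact_mod_cast Nat.one_le_two_pow
  have hBs : ∀ s : Finset (Fin m → ℤ), 0 ∉ s →
      ∑ h ∈ s, errTerm (2 * M + 1) (M' ^ d) α h ≤
        |B| * ((2 / Real.log 2) ^ p * Real.log R ^ p) := by
    intro s hs
    calc ∑ h ∈ s, errTerm (2 * M + 1) (M' ^ d) α h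
        ≤ ∑ h ∈ s, errTerm (2 * M' + 1) (M' ^ d) α h :=
          Finset.sum_le_sum fun h _ => errTerm_mono (by positivity) (by linarith) _ _ _
      _ ≤ B * ((2 : ℝ) ^ i) ^ p := hB i s hs
      _ ≤ |B| * ((2 : ℝ) ^ i) ^ p := by gcongr; exact le_abs_self B
      _ ≤ |B| * (2 / Real.log 2 * Real.log R) ^ p := by gcongr
      _ = _ := by rw [Real.mul_rpow (by positivity) (by linarith)]
  have hpos : 0 < M' ^ d := by positivity
  refine (abs_sum_indicator_sub_le hpos ha hab hb hJ hJ' w α hBs).trans ?_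
  -- Because H = M'^d is comparable to, or larger than, the number of points, the smoothing error is
  -- O(1). It is absorbed using log R ≥ log 2.
  have h1 : (2 * (M : ℝ) + 1) ^ d * (3 ^ m / ((M' ^ d : ℕ) : ℝ)) ≤ 3 ^ d * 3 ^ m := by
    have : (2 * (M : ℝ) + 1) ^ d ≤ (3 * M') ^ d := by
      gcongr; linarith
    rw [mul_pow] at this
    push_cast
    rw [← mul_div_assoc, div_le_iff₀ (by positivity)]
    calc (2 * (M : ℝ) + 1) ^ d * 3 ^ m ≤ (3 ^ d * M' ^ d) * 3 ^ m := by gcongr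
      _ = _ := by ring
  have h2 : (3 : ℝ) ^ d * 3 ^ m ≤ C₁ * Real.log R ^ p := by
    have : Real.log 2 ^ p ≤ Real.log R ^ p := Real.rpow_le_rpow hl2.le hlR hp0.le
    have hlp : 0 < Real.log 2 ^ p := Real.rpow_pos_of_pos hl2 p
    rw [hC₁, mul_assoc]
    have : 1 ≤ (Real.log 2 ^ p)⁻¹ * Real.log R ^ p := by
      rw [inv_mul_eq_div, one_le_div hlp]; exact this
    exact le_mul_of_one_le_right (by positivity) this
  have h3 : 2 ^ d * (|B| * ((2 / Real.log 2) ^ p * Real.log R ^ p)) = C₂ * Real.log R ^ p := by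
    rw [hC₂]; ring
  rw [h3, add_mul]
  linarith

end CutProject

/-! ### Decomposition of acceptance sets into boxes -/

namespace CutProject

theorem exists_Ioo_subset_subset_Icc {J : Set ℝ} (hJ : J ⊆ Set.Ico 0 1) (hc : J.OrdConnected) :
    ∃ a b : ℝ, 0 ≤ a ∧ a ≤ b ∧ b ≤ 1 ∧ Set.Ioo a b ⊆ J ∧ J ⊆ Set.Icc a b := by
  rcases J.eq_empty_or_nonempty with rfl | hne
  · exact ⟨0, 0, le_rfl, le_rfl, zero_le_one, by simp, by simp⟩
  · have hbb : BddBelow J := ⟨0, fun x hx => (hJ hx).1⟩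
    have hba : BddAbove J := ⟨1, fun x hx => (hJ hx).2.le⟩
    refine ⟨sInf J, sSup J, le_csInf hne fun x hx => (hJ hx).1, csInf_le_csSup hne hbb hba,
      csSup_le hne fun x hx => (hJ hx).2.le, ?_,
      fun x hx => ⟨csInf_le hbb hx, le_csSup hba hx⟩⟩
    rintro x ⟨h1, h2⟩
    obtain ⟨y, hy, hyx⟩ := exists_lt_of_csInf_lt hne h1
    obtain ⟨z, hz, hxz⟩ := exists_lt_of_lt_csSup hne h2
    exact hc.out hy hz ⟨hyx.le, hxz.le⟩

/-- The points t, u, v lie in an interval of length less than 1, where the floor has at most one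
jump, of size 1. -/
theorem floor_sub_eq_or {t u v : ℝ} (ht : 0 ≤ t) (hv : v < 1) (htu : t ≤ u) (huv : u ≤ v)
    (β : ℝ) : ⌊u - β⌋ = ⌊t - β⌋ ∨ ⌊u - β⌋ = ⌊v - β⌋ := by
  have h1 : ⌊t - β⌋ ≤ ⌊u - β⌋ := Int.floor_le_floor (by linarith)
  have h2 : ⌊u - β⌋ ≤ ⌊v - β⌋ := Int.floor_le_floor (by linarith)
  have h3 : ⌊v - β⌋ ≤ ⌊t - β⌋ + 1 := by
    rw [← Int.floor_add_one]; exact Int.floor_le_floor (by linarith)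
  omega

theorem ordConnected_floor {ι : Type*} (P : ι → ℤ → Prop) (β : ι → ℝ) :
    {t : ℝ | t ∈ Set.Ico (0 : ℝ) 1 ∧ ∀ n, P n ⌊t - β n⌋}.OrdConnected := by
  refine ⟨fun t ht v hv u hu => ⟨⟨ht.1.1.trans hu.1, hu.2.trans_lt hv.1.2⟩, fun n => ?_⟩⟩
  rcases floor_sub_eq_or ht.1.1 hv.1.2 hu.1 hu.2 (β n) with h | h <;> rw [h]
  exacts [ht.2 n, hv.2 n]

variable {d m : ℕ}

/-- The linear map with coefficients `α` at an integer point. -/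
noncomputable def phase (α : Fin m → Fin d → ℝ) (n : Fin d → ℤ) (i : Fin m) : ℝ :=
  ∑ j, α i j * n j

/-- The unit cube `[0, 1)^m`. -/
def unitCube (m : ℕ) : Set (Fin m → ℝ) := {w | ∀ i, w i ∈ Set.Ico (0 : ℝ) 1}

/-- The integer part of `w - L n`. -/
noncomputable def phaseFloor (α : Fin m → Fin d → ℝ) (w : Fin m → ℝ) (n : Fin d → ℤ) :
    Fin m → ℤ := fun i => ⌊w i - phase α n i⌋

/-- The points `w` whose phase floors agree with those of `w₀` wherever the condition `cond` holds
for one of them. -/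
def acceptance (α : Fin m → Fin d → ℝ) (cond : (Fin d → ℤ) → (Fin m → ℤ) → Prop)
    (w₀ : Fin m → ℝ) : Set (Fin m → ℝ) :=
  {w | ∀ n, cond n (phaseFloor α w n) ∨ cond n (phaseFloor α w₀ n) →
    phaseFloor α w n = phaseFloor α w₀ n}

/-- `cond` is independent of the point of the unit cube, except at the frequencies in `S`. -/
def IsDeterminedOff (α : Fin m → Fin d → ℝ) (cond : (Fin d → ℤ) → (Fin m → ℤ) → Prop)
    (S : Finset (Fin d → ℤ)) : Prop :=
  ∀ n ∉ S, ∀ w ∈ unitCube m, ∀ w' ∈ unitCube m,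
    cond n (phaseFloor α w n) → cond n (phaseFloor α w' n)

open Classical in
/-- The number of `n ∈ S` for which `phase α n i` modulo `1` is at most `t`. -/
noncomputable def cutCount (α : Fin m → Fin d → ℝ) (S : Finset (Fin d → ℤ)) (i : Fin m)
    (t : ℝ) : ℕ :=
  (S.filter fun n => ⌊0 - phase α n i⌋ < ⌊t - phase α n i⌋).card

theorem cutCount_mono (α : Fin m → Fin d → ℝ) (S : Finset (Fin d → ℤ)) (i : Fin m) :
    Monotone (cutCount α S i) := by
  intro t u htu
  refine Finset.card_le_card (Finset.monotone_filter_right _ fun n _ h => ?_)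
  exact h.trans_le (Int.floor_le_floor (by linarith))

theorem cutCount_le (α : Fin m → Fin d → ℝ) (S : Finset (Fin d → ℤ)) (i : Fin m) (t : ℝ) :
    cutCount α S i t ≤ S.card := Finset.card_filter_le _ _

/-- The sets counted by `cutCount` increase with t, so equal cardinalities force equal sets. Each
floor has at most two values on [0,1), and membership tells which one occurs. -/
theorem floor_eq_of_cutCount_eq {α : Fin m → Fin d → ℝ} {S : Finset (Fin d → ℤ)} {i : Fin m}
    {t u : ℝ} (ht : t ∈ Set.Ico (0 : ℝ) 1) (hu : u ∈ Set.Ico (0 : ℝ) 1)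
    (h : cutCount α S i t = cutCount α S i u) {n : Fin d → ℤ} (hn : n ∈ S) :
    ⌊t - phase α n i⌋ = ⌊u - phase α n i⌋ := by
  classical
  wlog htu : t ≤ u generalizing t u
  · exact (this hu ht h.symm (le_of_not_ge htu)).symm
  have hsub : (S.filter fun n => ⌊0 - phase α n i⌋ < ⌊t - phase α n i⌋) ⊆
      S.filter fun n => ⌊0 - phase α n i⌋ < ⌊u - phase α n i⌋ :=
    Finset.monotone_filter_right _ fun n _ h => h.trans_le (Int.floor_le_floor (by linarith))
  unfold cutCount at h
  have heq := Finset.eq_of_subset_of_card_le hsub (by convert h.ge)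
  have hmem := Finset.ext_iff.1 heq n
  simp only [Finset.mem_filter, hn, true_and] at hmem
  have h1 := floor_sub_eq_or le_rfl hu.2 ht.1 htu (phase α n i)
  have h2 : ⌊0 - phase α n i⌋ ≤ ⌊t - phase α n i⌋ := Int.floor_le_floor (by linarith [ht.1])
  have h3 : ⌊t - phase α n i⌋ ≤ ⌊u - phase α n i⌋ := Int.floor_le_floor (by linarith)
  omega

/-- For n ∉ S the condition does not depend on w, and when it holds the requirement of equal floors
is imposed coordinatewise. For n ∈ S, fixing the cut counts fixes all floors outside i₀, so only ⌊w
i₀ - phase⌋ varies, and any condition on it defines an interval. Leaving i₀ unsubdivided is what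
gives the exponent m - 1 in the number of cells. -/
theorem exists_box_cell {α : Fin m → Fin d → ℝ} {cond : (Fin d → ℤ) → (Fin m → ℤ) → Prop}
    {S : Finset (Fin d → ℤ)} (hS : IsDeterminedOff α cond S) {w₀ : Fin m → ℝ}
    (hw₀ : w₀ ∈ unitCube m) (i₀ : Fin m) (c : Fin m → ℕ) :
    ∃ J : Fin m → Set ℝ, (∀ i, J i ⊆ Set.Ico 0 1) ∧ (∀ i, (J i).OrdConnected) ∧
      ∀ w ∈ unitCube m, (∀ i, w i ∈ J i) ↔
        w ∈ acceptance α cond w₀ ∧ ∀ i ≠ i₀, cutCount α S i (w i) = c i := by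
  classical
  by_cases hne : ∃ w₁ ∈ unitCube m, ∀ i ≠ i₀, cutCount α S i (w₁ i) = c i
  swap
  · refine ⟨fun _ => ∅, fun _ => Set.empty_subset _, fun _ => Set.ordConnected_empty,
      fun w hw => ⟨fun h => (h i₀).elim, fun h => (hne ⟨w, hw, h.2⟩).elim⟩⟩
  obtain ⟨w₁, hw₁, hw₁c⟩ := hne
  set good : Fin m → ℝ → Prop := fun i t => ∀ n : (Fin d → ℤ), n ∉ S →
    cond n (phaseFloor α w₀ n) → ⌊t - phase α n i⌋ = phaseFloor α w₀ n i with hgood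
  set Φ : (Fin d → ℤ) → (Fin m → ℤ) → Prop := fun n z =>
    cond n z ∨ cond n (phaseFloor α w₀ n) → z = phaseFloor α w₀ n with hΦ
  have hgood_conn : ∀ i, {t : ℝ | t ∈ Set.Ico (0 : ℝ) 1 ∧ good i t}.OrdConnected := fun i =>
    ordConnected_floor (fun n z => n ∉ S → cond n (phaseFloor α w₀ n) → z = phaseFloor α w₀ n i)
      fun n => phase α n i
  -- The floors of the sample point w₁ stand in for the fixed floors in the coordinates other than
  -- i₀.
  refine ⟨fun i => {t : ℝ | t ∈ Set.Ico (0 : ℝ) 1 ∧ good i t} ∩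
    (if i = i₀ then {t : ℝ | t ∈ Set.Ico (0 : ℝ) 1 ∧ ∀ n, n ∈ S →
      Φ n (Function.update (phaseFloor α w₁ n) i₀ ⌊t - phase α n i₀⌋)} else
      {t : ℝ | cutCount α S i t = c i}), fun i t ht => ht.1.1, fun i => ?_, fun w hw => ?_⟩
  · refine (hgood_conn i).inter ?_
    split_ifs
    · exact ordConnected_floor (fun n z => n ∈ S → Φ n (Function.update (phaseFloor α w₁ n) i₀ z))
        fun n => phase α n i₀
    · refine ⟨fun t ht v hv u hu => ?_⟩
      have h1 := cutCount_mono α S i hu.1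
      have h2 := cutCount_mono α S i hu.2
      have h3 : cutCount α S i t = c i := ht
      have h4 : cutCount α S i v = c i := hv
      exact le_antisymm (h2.trans h4.le) (h3.ge.trans h1)
  · have hupd : (∀ i ≠ i₀, cutCount α S i (w i) = c i) → ∀ n ∈ S,
        Function.update (phaseFloor α w₁ n) i₀ ⌊w i₀ - phase α n i₀⌋ = phaseFloor α w n := by
      intro h n hn
      funext i
      by_cases hi : i = i₀
      · subst hi; rw [Function.update_self]; rfl
      · rw [Function.update_of_ne hi]
        exact floor_eq_of_cutCount_eq (hw₁ i) (hw i) ((hw₁c i hi).trans (h i hi).symm) hn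
    constructor
    · intro h
      have hc : ∀ i ≠ i₀, cutCount α S i (w i) = c i := by
        intro i hi
        have := (h i).2
        rwa [if_neg hi] at this
      refine ⟨fun n => ?_, hc⟩
      by_cases hn : n ∈ S
      · have := (h i₀).2
        rw [if_pos rfl] at this
        have := this.2 n hn
        rwa [hupd hc n hn] at this
      · intro hcond
        have hcond' : cond n (phaseFloor α w₀ n) :=
          hcond.elim (fun hc => hS n hn w hw w₀ hw₀ hc) id
        funext i
        exact (h i).1.2 n hn hcond'
    · rintro ⟨hA, hc⟩ i
      refine ⟨⟨hw i, fun n _ hcond => congrFun (hA n (Or.inr hcond)) i⟩, ?_⟩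
      split_ifs with hi
      · subst hi
        refine ⟨hw i, fun n hn => ?_⟩
        rw [hupd hc n hn]
        exact hA n
      · exact hc i hi

theorem prod_indicator_eq {J : Fin m → Set ℝ} (w : Fin m → ℝ) [Decidable (∀ i, w i ∈ J i)] :
    ∏ i, (J i).indicator (1 : ℝ → ℝ) (w i) = if ∀ i, w i ∈ J i then 1 else 0 := by
  split_ifs with h
  · exact Finset.prod_eq_one fun i _ => by rw [Set.indicator_of_mem (h i), Pi.one_apply]
  · push Not at h
    obtain ⟨i, hi⟩ := h
    exact Finset.prod_eq_zero (Finset.mem_univ i) (Set.indicator_of_notMem hi _)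

/-- The reduction of `w - L n` modulo `1`. -/
noncomputable def phaseFract (α : Fin m → Fin d → ℝ) (w : Fin m → ℝ) (n : Fin d → ℤ) :
    Fin m → ℝ := fun i => Int.fract (w i - phase α n i)

theorem phaseFract_mem (α : Fin m → Fin d → ℝ) (w : Fin m → ℝ) (n : Fin d → ℤ) :
    phaseFract α w n ∈ unitCube m := fun _ => ⟨Int.fract_nonneg _, Int.fract_lt_one _⟩

-- Sums the box discrepancy over the (|S| + 1)^(m-1) cells. V, the total volume of the boxes,
-- depends neither on w nor on R, so it will be the frequency.
open Classical in
theorem exists_abs_card_acceptance_sub_le {α : Fin m → Fin d → ℝ} {p C : ℝ}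
    (hα : HasSmallDiscrepancy α p C) (hm : 0 < m)
    {cond : (Fin d → ℤ) → (Fin m → ℤ) → Prop} {S : Finset (Fin d → ℤ)}
    (hS : IsDeterminedOff α cond S) {w₀ : Fin m → ℝ} (hw₀ : w₀ ∈ unitCube m) :
    ∃ V : ℝ, ∀ R : ℝ, 2 ≤ R → ∀ w : Fin m → ℝ,
      |(((intCube d ⌊R⌋₊).filter fun n => phaseFract α w n ∈ acceptance α cond w₀).card : ℝ) -
        (2 * (⌊R⌋₊ : ℝ) + 1) ^ d * V| ≤ (S.card + 1) ^ (m - 1) * (C * Real.log R ^ p) := by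
  set i₀ : Fin m := ⟨0, hm⟩
  choose J hJ1 hJ2 hJ3 using exists_box_cell hS hw₀ i₀
  choose a b ha hab hb hJa hJb using fun c i => exists_Ioo_subset_subset_Icc (hJ1 c i) (hJ2 c i)
  -- The index at i₀ is a dummy, pinned to 0 so that each cell is counted once.
  set cells : Finset (Fin m → ℕ) :=
    Fintype.piFinset fun i => if i = i₀ then {0} else Finset.range (S.card + 1) with hcells
  have hcard : cells.card = (S.card + 1) ^ (m - 1) := by
    rw [hcells, Fintype.card_piFinset, ← Finset.mul_prod_erase _ _ (Finset.mem_univ i₀)]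
    rw [if_pos rfl, Finset.card_singleton, one_mul]
    rw [Finset.prod_congr rfl fun i hi => by rw [if_neg (Finset.ne_of_mem_erase hi)]]
    rw [Finset.prod_const, Finset.card_range, Finset.card_erase_of_mem (Finset.mem_univ i₀),
      Finset.card_univ, Fintype.card_fin]
  have hind : ∀ w ∈ unitCube m, ∑ c ∈ cells, ∏ i, (J c i).indicator (1 : ℝ → ℝ) (w i) =
      if w ∈ acceptance α cond w₀ then 1 else 0 := by
    intro w hw
    simp_rw [prod_indicator_eq, hJ3 _ w hw]
    set c₁ : Fin m → ℕ := fun i => if i = i₀ then 0 else cutCount α S i (w i) with hc₁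
    have hc₁mem : c₁ ∈ cells := by
      rw [hcells, Fintype.mem_piFinset]
      intro i
      by_cases hi : i = i₀
      · simp [hc₁, hi]
      · simp only [hc₁, hi, if_false, Finset.mem_range]
        exact Nat.lt_succ_of_le (cutCount_le α S i (w i))
    rw [Finset.sum_eq_single c₁]
    · refine if_congr ⟨fun h => h.1, fun h => ⟨h, fun i hi => ?_⟩⟩ rfl rfl
      rw [hc₁]; simp only [hi, if_false]
    · intro c hc hne
      refine if_neg fun h => hne ?_
      funext i
      by_cases hi : i = i₀
      · have := Fintype.mem_piFinset.1 hc i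
        rw [if_pos hi, Finset.mem_singleton] at this
        simp [hc₁, hi, ← this]
      · rw [hc₁]; simp only [hi, if_false]; exact (h.2 i hi).symm
    · exact fun h => (h hc₁mem).elim
  refine ⟨∑ c ∈ cells, ∏ i, (b c i - a c i), fun R hR w => ?_⟩
  have e : (((intCube d ⌊R⌋₊).filter fun n =>
      phaseFract α w n ∈ acceptance α cond w₀).card : ℝ) =
      ∑ c ∈ cells, ∑ n ∈ intCube d ⌊R⌋₊,
        ∏ i, (J c i).indicator (1 : ℝ → ℝ) (Int.fract (w i - ∑ j, α i j * n j)) := by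
    rw [Finset.sum_comm, Finset.card_filter]
    push_cast
    exact Finset.sum_congr rfl fun n _ => (hind _ (phaseFract_mem α w n)).symm
  rw [e, Finset.mul_sum, ← Finset.sum_sub_distrib]
  refine (Finset.abs_sum_le_sum_abs _ _).trans ?_
  refine (Finset.sum_le_sum fun c _ => hα R hR w (a c) (b c) (J c) (ha c) (hab c) (hb c) (hJa c)
    (hJb c)).trans_eq ?_
  rw [Finset.sum_const, hcard, nsmul_eq_mul]
  push_cast
  rfl

end CutProject

/-! ### Internal coordinates and the points of `Y` -/

namespace CutProject

variable {d m : ℕ}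

/-- The internal coordinate `z - L x` of a point `(x, z)`. -/
noncomputable def internalCoord (α : Fin m → Fin d → ℝ) (v : TotalSpace d m) : Fin m → ℝ :=
  v.2 - linMap α v.1

theorem internalCoord_add (α : Fin m → Fin d → ℝ) (u v : TotalSpace d m) :
    internalCoord α (u + v) = internalCoord α u + internalCoord α v := by
  simp only [internalCoord, Prod.fst_add, Prod.snd_add, map_add]
  abel

theorem internalCoord_eq_zero {α : Fin m → Fin d → ℝ} {v : TotalSpace d m}
    (hv : v ∈ physicalSpace α) : internalCoord α v = 0 := by
  rw [physicalSpace, LinearMap.mem_graph_iff] at hv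
  rw [internalCoord, hv, sub_self]

theorem linMap_intCast (α : Fin m → Fin d → ℝ) (n : Fin d → ℤ) :
    linMap α (fun j => (n j : ℝ)) = phase α n := by
  funext i
  simp [linMap, phase, Matrix.mulVec, dotProduct]

/-- The lattice point with coordinates `n`, `z`. -/
def intVec (n : Fin d → ℤ) (z : Fin m → ℤ) : TotalSpace d m := (fun j => (n j : ℝ), fun i => (z i : ℝ))

theorem intVec_mem (n : Fin d → ℤ) (z : Fin m → ℤ) : intVec n z ∈ integerLattice d m :=
  ⟨fun j => ⟨n j, rfl⟩, fun i => ⟨z i, rfl⟩⟩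

theorem exists_eq_intVec {u : TotalSpace d m} (hu : u ∈ integerLattice d m) :
    ∃ n z, u = intVec n z := by
  choose n hn using hu.1
  choose z hz using hu.2
  exact ⟨n, z, Prod.ext (funext hn) (funext hz)⟩

theorem intVec_inj {n n' : Fin d → ℤ} {z z' : Fin m → ℤ} (h : intVec n z = intVec n' z') :
    n = n' ∧ z = z' := by
  constructor
  · funext j
    have := congrFun (congrArg Prod.fst h) j
    exact Int.cast_injective (α := ℝ) this
  · funext i
    have := congrFun (congrArg Prod.snd h) i
    exact Int.cast_injective (α := ℝ) this

theorem internalCoord_intVec (α : Fin m → Fin d → ℝ) (n : Fin d → ℤ) (z : Fin m → ℤ) (i : Fin m) :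
    internalCoord α (intVec n z) i = z i - phase α n i := by
  rw [internalCoord, intVec, linMap_intCast]; rfl

theorem add_intVec_mem {s v : TotalSpace d m} (hv : v ∈ shiftedLattice s) (n : Fin d → ℤ)
    (z : Fin m → ℤ) : v + intVec n z ∈ shiftedLattice s := by
  obtain ⟨n', z', h⟩ := exists_eq_intVec hv
  have : v + intVec n z - s = intVec (n' + n) (z' + z) := by
    rw [add_sub_right_comm, h]
    ext <;> simp [intVec]
  show v + intVec n z - s ∈ integerLattice d m
  rw [this]
  exact intVec_mem _ _

theorem exists_eq_add_intVec {s v v' : TotalSpace d m} (hv : v ∈ shiftedLattice s)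
    (hv' : v' ∈ shiftedLattice s) : ∃ n z, v' = v + intVec n z := by
  obtain ⟨n, z, h⟩ := exists_eq_intVec hv
  obtain ⟨n', z', h'⟩ := exists_eq_intVec hv'
  refine ⟨n' - n, z' - z, ?_⟩
  have : v' = v + ((v' - s) - (v - s)) := by abel
  rw [this, h, h']
  congr 1
  ext <;> simp [intVec]

namespace CubicalScheme

variable {α : Fin m → Fin d → ℝ} (D : CubicalScheme α)

theorem proj_mem (v : TotalSpace d m) : D.proj v ∈ physicalSpace α :=
  Submodule.projection_apply_mem D.isCompl v

theorem proj_add_projStar (v : TotalSpace d m) : D.proj v + D.projStar v = v :=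
  Submodule.projection_add_projection_eq_self D.isCompl v

/-- Adding elements of E does not change the internal coordinate, and `projStar` preserves it. Hence
the slice does not depend on the choice of F_π. -/
theorem mem_slice_iff (v : TotalSpace d m) :
    v ∈ D.slice ↔ ∀ i, internalCoord α v i ∈ Set.Icc (0 : ℝ) 1 := by
  have hstar : ∀ u, internalCoord α (D.projStar u) = internalCoord α u := by
    intro u
    have := congrArg (internalCoord α) (D.proj_add_projStar u)
    rwa [internalCoord_add, internalCoord_eq_zero (D.proj_mem u), zero_add] at this
  have hz : ∀ z : Fin m → ℝ, internalCoord α ((0, z) : TotalSpace d m) = z := by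
    intro z; simp [internalCoord]
  constructor
  · rintro ⟨_, ⟨⟨x, z⟩, ⟨hx, hz'⟩, rfl⟩, e, he, rfl⟩ i
    obtain rfl : x = 0 := hx
    simp only
    rw [internalCoord_add, hstar, hz, internalCoord_eq_zero he, add_zero]
    exact ⟨hz'.1 i, hz'.2 i⟩
  · intro h
    refine ⟨D.projStar (0, internalCoord α v), ⟨_, ⟨Set.mem_singleton _, fun i => (h i).1, fun i => (h i).2⟩, rfl⟩,
      D.proj (0, internalCoord α v) + (v.1, linMap α v.1), ?_, ?_⟩
    · exact Submodule.add_mem _ (D.proj_mem _) (by simp [physicalSpace, LinearMap.mem_graph_iff])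
    · simp only
      rw [← add_assoc, add_comm (D.projStar _), D.proj_add_projStar]
      ext <;> simp [internalCoord]

/-- Regularity puts v in the interior of the slice, so the i-th coordinate can be moved a little in
both directions without leaving it. -/
theorem internalCoord_mem_Ioo {s : TotalSpace d m} (hs : D.IsRegular s) {v : TotalSpace d m}
    (hv : v ∈ D.slice) (hvs : v ∈ shiftedLattice s) (i : Fin m) :
    internalCoord α v i ∈ Set.Ioo (0 : ℝ) 1 := by
  have hint : v ∈ interior D.slice := by
    by_contra h
    have : v ∈ frontier D.slice ∩ shiftedLattice s := ⟨⟨subset_closure hv, h⟩, hvs⟩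
    rw [hs] at this
    exact this
  have hcont : Continuous fun t : ℝ => v + ((0, Pi.single i t) : TotalSpace d m) := by
    have h1 : Continuous fun t : ℝ => (Pi.single i t : Fin m → ℝ) :=
      continuous_single (A := fun _ => ℝ) i
    fun_prop
  have hcoord : ∀ t : ℝ, internalCoord α (v + ((0, Pi.single i t) : TotalSpace d m)) i =
      internalCoord α v i + t := by
    intro t
    rw [internalCoord_add]
    simp [internalCoord]
  have hev : ∀ᶠ t : ℝ in 𝓝 0, v + ((0, Pi.single i t) : TotalSpace d m) ∈ D.slice := by
    refine hcont.continuousAt.eventually_mem ?_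
    rw [Pi.single_zero, Prod.mk_zero_zero, add_zero]
    exact mem_interior_iff_mem_nhds.1 hint
  obtain ⟨δ, hδ, hball⟩ := Metric.eventually_nhds_iff.1 hev
  have h1 := (D.mem_slice_iff _).1 (hball (y := δ / 2) (by
    rw [Real.dist_eq, sub_zero, abs_of_pos (by positivity)]; linarith)) i
  have h2 := (D.mem_slice_iff _).1 (hball (y := -(δ / 2)) (by
    rw [Real.dist_eq, sub_zero, abs_neg, abs_of_pos (by positivity)]; linarith)) i
  rw [hcoord] at h1 h2
  exact ⟨by linarith [h2.1], by linarith [h1.2]⟩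

theorem injOn_shiftedLattice (s : TotalSpace d m) : Set.InjOn D.proj (shiftedLattice s) := by
  intro v hv v' hv' h
  have : D.proj (v - s) = D.proj (v' - s) := by rw [map_sub, map_sub, h]
  exact sub_left_injective (D.injOn hv hv' this)

theorem lift_proj {s v : TotalSpace d m} (hv : v ∈ shiftedLattice s) :
    D.lift s (D.proj v) = v :=
  (D.injOn_shiftedLattice s).leftInvOn_invFunOn hv

theorem lift_spec {s y : TotalSpace d m} (hy : y ∈ D.pointSet s) :
    D.lift s y ∈ D.slice ∧ D.lift s y ∈ shiftedLattice s ∧ D.proj (D.lift s y) = y := by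
  obtain ⟨v, ⟨h1, h2⟩, rfl⟩ := hy
  rw [D.lift_proj h2]
  exact ⟨h1, h2, rfl⟩

/-- The displacement from a lattice point with internal coordinate `w` to the lattice point of the
slice over `n`. -/
noncomputable def step (α : Fin m → Fin d → ℝ) (w : Fin m → ℝ) (n : Fin d → ℤ) : TotalSpace d m :=
  intVec n (-phaseFloor α w n)

theorem internalCoord_add_step (v : TotalSpace d m) (n : Fin d → ℤ) :
    internalCoord α (v + step α (internalCoord α v) n) = phaseFract α (internalCoord α v) n := by
  funext i
  rw [internalCoord_add, Pi.add_apply, step, internalCoord_intVec, phaseFract, Int.fract]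
  simp only [Pi.neg_apply, phaseFloor]
  push_cast; ring

theorem add_step_mem_slice (v : TotalSpace d m) (n : Fin d → ℤ) :
    v + step α (internalCoord α v) n ∈ D.slice := by
  rw [mem_slice_iff, internalCoord_add_step]
  exact fun i => ⟨Int.fract_nonneg _, (Int.fract_lt_one _).le⟩

/-- By regularity the internal coordinate lies in an open unit interval, so the integer part of the
displacement is forced to be the floor. -/
theorem exists_eq_add_step {s : TotalSpace d m} (hs : D.IsRegular s) {v v' : TotalSpace d m}
    (hv : v ∈ shiftedLattice s) (hv' : v' ∈ shiftedLattice s) (hv's : v' ∈ D.slice) :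
    ∃ n, v' = v + step α (internalCoord α v) n := by
  obtain ⟨n, z, rfl⟩ := exists_eq_add_intVec hv hv'
  refine ⟨n, ?_⟩
  rw [step]
  congr 2
  funext i
  have h := D.internalCoord_mem_Ioo hs hv's hv' i
  rw [internalCoord_add, Pi.add_apply, internalCoord_intVec] at h
  have : phaseFloor α (internalCoord α v) n i = -z i := by
    rw [phaseFloor, Int.floor_eq_iff]
    push_cast
    exact ⟨by linarith [h.1], by linarith [h.2]⟩
  rw [Pi.neg_apply, this, neg_neg]

theorem internalCoord_mem_unitCube {s : TotalSpace d m} (hs : D.IsRegular s) {v : TotalSpace d m}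
    (hv : v ∈ D.slice) (hvs : v ∈ shiftedLattice s) : internalCoord α v ∈ unitCube m :=
  fun i => Set.Ioo_subset_Ico_self (D.internalCoord_mem_Ioo hs hv hvs i)

/-! ### Patch classes as acceptance sets -/

/-- The notion of patch `P` collects the points whose displacement in the total space satisfies the
condition `T`. -/
def IsPatchBy (P : TotalSpace d m → TotalSpace d m → Set (TotalSpace d m))
    (T : TotalSpace d m → Prop) : Prop :=
  ∀ s, ∀ y ∈ D.pointSet s, P s y = {y' | y' ∈ D.pointSet s ∧ T (D.lift s y' - D.lift s y)}

theorem isPatchBy_patchII (A : Set (TotalSpace d m)) :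
    D.IsPatchBy (D.patchII A) fun u => rho α u ∈ A := fun _ _ _ => rfl

theorem isPatchBy_patchI (A : Set (TotalSpace d m)) :
    D.IsPatchBy (D.patchI A) fun u => D.proj u ∈ A := by
  intro s y hy
  ext y'
  refine and_congr_right fun hy' => ?_
  simp only
  rw [map_sub, (D.lift_spec hy).2.2, (D.lift_spec hy').2.2]

/-- The condition on frequencies and phase floors induced by a condition on displacements. -/
def floorCond (T : TotalSpace d m → Prop) (n : Fin d → ℤ) (z : Fin m → ℤ) : Prop :=
  T (intVec n (-z))

variable {D} {P : TotalSpace d m → TotalSpace d m → Set (TotalSpace d m)}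
  {T : TotalSpace d m → Prop}

/-- Hence the class depends on y only through the internal coordinate of its lift. -/
theorem patchClass_eq (hP : D.IsPatchBy P T) {s y : TotalSpace d m} (hs : D.IsRegular s)
    (hy : y ∈ D.pointSet s) :
    patchClass P s y = D.proj '' {u | ∃ n,
      u = step α (internalCoord α (D.lift s y)) n ∧ T u} := by
  obtain ⟨h1, h2, h3⟩ := D.lift_spec hy
  ext x
  rw [patchClass, hP s y hy]
  constructor
  · rintro ⟨y', ⟨hy', hT⟩, rfl⟩
    obtain ⟨h1', h2', h3'⟩ := D.lift_spec hy'
    obtain ⟨n, hn⟩ := D.exists_eq_add_step hs h2 h2' h1'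
    refine ⟨D.lift s y' - D.lift s y, ⟨n, ?_, hT⟩, ?_⟩
    · rw [sub_eq_iff_eq_add']; exact hn
    · rw [map_sub, h3, h3']
  · rintro ⟨u, ⟨n, rfl, hT⟩, rfl⟩
    have hmem := add_intVec_mem h2 n (-phaseFloor α (internalCoord α (D.lift s y)) n)
    refine ⟨_, ⟨⟨_, ⟨D.add_step_mem_slice (D.lift s y) n, hmem⟩, rfl⟩, ?_⟩, ?_⟩
    · rw [step, D.lift_proj hmem, add_sub_cancel_left]
      exact hT
    · simp only
      rw [map_add, h3, add_sub_cancel_left]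

/-- Since π is injective on ℤ^k, equal classes mean equal sets of integer displacements. These agree
exactly when every n occurring for either point has the same floors for both. -/
theorem patchClass_eq_iff (hP : D.IsPatchBy P T) {s y s₀ y₀ : TotalSpace d m}
    (hs : D.IsRegular s) (hy : y ∈ D.pointSet s) (hs₀ : D.IsRegular s₀)
    (hy₀ : y₀ ∈ D.pointSet s₀) :
    patchClass P s y = patchClass P s₀ y₀ ↔ internalCoord α (D.lift s y) ∈
      acceptance α (floorCond T) (internalCoord α (D.lift s₀ y₀)) := by
  rw [patchClass_eq hP hs hy, patchClass_eq hP hs₀ hy₀]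
  have hsub : ∀ w, {u | ∃ n, u = step α w n ∧ T u} ⊆ integerLattice d m := by
    rintro w _ ⟨n, rfl, -⟩
    exact intVec_mem _ _
  have hinj : Set.InjOn D.proj (integerLattice d m) := D.injOn
  rw [hinj.image_eq_image_iff (hsub _) (hsub _)]
  set w := internalCoord α (D.lift s y)
  set w₀ := internalCoord α (D.lift s₀ y₀)
  constructor
  · intro h n hn
    rcases hn with hn | hn
    · have : step α w n ∈ {u | ∃ n, u = step α w n ∧ T u} := ⟨n, rfl, hn⟩
      rw [h] at this
      obtain ⟨n', hn', -⟩ := this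
      obtain ⟨rfl, h2⟩ := intVec_inj hn'
      exact neg_injective h2
    · have : step α w₀ n ∈ {u | ∃ n, u = step α w₀ n ∧ T u} := ⟨n, rfl, hn⟩
      rw [← h] at this
      obtain ⟨n', hn', -⟩ := this
      obtain ⟨rfl, h2⟩ := intVec_inj hn'
      exact (neg_injective h2).symm
  · intro h
    ext u
    constructor
    · rintro ⟨n, rfl, hT⟩
      exact ⟨n, by rw [step, step, h n (Or.inl hT)], hT⟩
    · rintro ⟨n, rfl, hT⟩
      exact ⟨n, by rw [step, step, h n (Or.inr hT)], hT⟩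

theorem mem_cylinder_intVec {R : ℝ} (hR : 0 ≤ R) (n : Fin d → ℤ) (z : Fin m → ℤ) :
    intVec n z ∈ cylinder d m R ↔ n ∈ intCube d ⌊R⌋₊ := by
  rw [Fintype.mem_piFinset]
  refine ⟨fun h i => ?_, fun h => ⟨intVec_mem n z, fun i => ?_⟩⟩
  · have h1 := (h.2 i).1
    have h2 := (h.2 i).2
    have e : ((⌊R⌋₊ : ℕ) : ℤ) = ⌊R⌋ := Int.natCast_floor_eq_floor hR
    simp only [intVec] at h1 h2
    rw [Finset.mem_Icc, e]
    refine ⟨?_, Int.le_floor.2 h2⟩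
    have : -n i ≤ ⌊R⌋ := Int.le_floor.2 (by push_cast; linarith)
    linarith
  · have h1 := Finset.mem_Icc.1 (h i)
    have hf := Nat.floor_le hR
    have h2 : -((⌊R⌋₊ : ℕ) : ℝ) ≤ n i := by exact_mod_cast h1.1
    have h3 : (n i : ℝ) ≤ ((⌊R⌋₊ : ℕ) : ℝ) := by exact_mod_cast h1.2
    exact ⟨by simp only [intVec]; linarith, by simp only [intVec]; linarith⟩

/-- Parametrises the box by n. Taking W to be everything shows that the box has exactly (2⌊R⌋ + 1)^d
points, so the denominator of the frequency carries no error. -/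
theorem box_filter_eq {s y : TotalSpace d m} (hs : D.IsRegular s) (hy : y ∈ D.pointSet s) {R : ℝ}
    (hR : 0 ≤ R) (W : Set (Fin m → ℝ)) :
    {y' | y' ∈ D.box s y R ∧ internalCoord α (D.lift s y') ∈ W}.ncard =
      ((intCube d ⌊R⌋₊ : Set (Fin d → ℤ)) ∩
        {n | phaseFract α (internalCoord α (D.lift s y)) n ∈ W}).ncard := by
  obtain ⟨h1, h2, h3⟩ := D.lift_spec hy
  set v := D.lift s y with hv
  have hmem : ∀ n, v + step α (internalCoord α v) n ∈ shiftedLattice s := fun n =>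
    add_intVec_mem h2 n _
  have hinj : Function.Injective fun n => D.proj (v + step α (internalCoord α v) n) := by
    intro n n' h
    have := D.injOn_shiftedLattice s (hmem n) (hmem n') h
    exact (intVec_inj (add_left_cancel this)).1
  rw [← Set.ncard_image_of_injective _ hinj]
  congr 1
  ext y'
  constructor
  · rintro ⟨⟨hy', hc⟩, hW⟩
    obtain ⟨h1', h2', h3'⟩ := D.lift_spec hy'
    obtain ⟨n, hn⟩ := D.exists_eq_add_step hs h2 h2' h1'
    rw [← hv, hn, add_sub_cancel_left] at hc
    refine ⟨n, ⟨(mem_cylinder_intVec hR _ _).1 hc, ?_⟩, ?_⟩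
    · rw [hn, internalCoord_add_step] at hW
      exact hW
    · simp only
      rw [← hn, h3']
  · rintro ⟨n, ⟨hn, hW⟩, rfl⟩
    refine ⟨⟨⟨_, ⟨D.add_step_mem_slice v n, hmem n⟩, rfl⟩, ?_⟩, ?_⟩
    · rw [D.lift_proj (hmem n), ← hv, add_sub_cancel_left]
      exact (mem_cylinder_intVec hR _ _).2 hn
    · rw [D.lift_proj (hmem n), internalCoord_add_step]
      exact hW

open Classical in
theorem freqEstimate_eq (hP : D.IsPatchBy P T) {s y s₀ y₀ : TotalSpace d m}
    (hs : D.IsRegular s) (hy : y ∈ D.pointSet s) (hs₀ : D.IsRegular s₀)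
    (hy₀ : y₀ ∈ D.pointSet s₀) {R : ℝ} (hR : 0 ≤ R) :
    D.freqEstimate P (patchClass P s₀ y₀) s y R =
      (((intCube d ⌊R⌋₊).filter fun n => phaseFract α (internalCoord α (D.lift s y)) n ∈
        acceptance α (floorCond T) (internalCoord α (D.lift s₀ y₀))).card : ℝ) /
        (2 * (⌊R⌋₊ : ℝ) + 1) ^ d := by
  have e1 := box_filter_eq hs hy hR
    (acceptance α (floorCond T) (internalCoord α (D.lift s₀ y₀)))
  have e2 := box_filter_eq hs hy hR Set.univ
  simp only [Set.mem_univ, and_true, Set.ofPred_true, Set.inter_univ, Set.ofPred_mem_eq] at e2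
  rw [Set.ncard_coe_finset, card_intCube] at e2
  rw [freqEstimate, e2]
  have e3 : {y' | y' ∈ D.box s y R ∧ patchClass P s y' = patchClass P s₀ y₀} =
      {y' | y' ∈ D.box s y R ∧ internalCoord α (D.lift s y') ∈
        acceptance α (floorCond T) (internalCoord α (D.lift s₀ y₀))} := by
    ext y'
    exact and_congr_right fun h => patchClass_eq_iff hP hs h.1 hs₀ hy₀
  rw [e3, e1]
  have e4 : (intCube d ⌊R⌋₊ : Set (Fin d → ℤ)) ∩
      {n | phaseFract α (internalCoord α (D.lift s y)) n ∈
        acceptance α (floorCond T) (internalCoord α (D.lift s₀ y₀))} =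
      (((intCube d ⌊R⌋₊).filter fun n => phaseFract α (internalCoord α (D.lift s y)) n ∈
        acceptance α (floorCond T) (internalCoord α (D.lift s₀ y₀)) : Finset _) :
          Set (Fin d → ℤ)) := by
    ext n
    rw [Finset.coe_filter]
    exact Iff.rfl
  rw [e4, Set.ncard_coe_finset]
  push_cast
  rfl

theorem freqEstimate_mem_Icc (hP : D.IsPatchBy P T) {s y s₀ y₀ : TotalSpace d m}
    (hs : D.IsRegular s) (hy : y ∈ D.pointSet s) (hs₀ : D.IsRegular s₀)
    (hy₀ : y₀ ∈ D.pointSet s₀) {R : ℝ} (hR : 0 ≤ R) :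
    D.freqEstimate P (patchClass P s₀ y₀) s y R ∈ Set.Icc (0 : ℝ) 1 := by
  classical
  rw [freqEstimate_eq hP hs hy hs₀ hy₀ hR]
  refine ⟨by positivity, div_le_one_of_le₀ ?_ (by positivity)⟩
  have h := Finset.card_filter_le (intCube d ⌊R⌋₊) fun n =>
    phaseFract α (internalCoord α (D.lift s y)) n ∈
      acceptance α (floorCond T) (internalCoord α (D.lift s₀ y₀))
  rw [card_intCube] at h
  exact_mod_cast h

/-- The trivial bound by 1 is kept beside the discrepancy bound because the latter is useless for
small R when |S| is large. -/
theorem exists_hasFrequency {p C : ℝ} (hα : HasSmallDiscrepancy α p C) (hd : 0 < d) (hm : 0 < m)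
    (hC : 0 ≤ C) (hP : D.IsPatchBy P T) {S : Finset (Fin d → ℤ)}
    (hS : IsDeterminedOff α (floorCond T) S) {s₀ y₀ : TotalSpace d m} (hs₀ : D.IsRegular s₀)
    (hy₀ : y₀ ∈ D.pointSet s₀) :
    ∃ ξ : ℝ, D.HasFrequency P (patchClass P s₀ y₀) ξ ∧
      ∀ s, D.IsRegular s → ∀ y ∈ D.pointSet s, ∀ R : ℝ, 2 ≤ R →
        |D.freqEstimate P (patchClass P s₀ y₀) s y R - ξ| ≤
            (S.card + 1) ^ (m - 1) * (C * Real.log R ^ p) / R ^ d ∧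
          |D.freqEstimate P (patchClass P s₀ y₀) s y R - ξ| ≤ 1 := by
  classical
  obtain ⟨hsl, hsh, -⟩ := D.lift_spec hy₀
  obtain ⟨ξ, hξ⟩ := exists_abs_card_acceptance_sub_le hα hm hS
    (D.internalCoord_mem_unitCube hs₀ hsl hsh)
  have bound : ∀ s, D.IsRegular s → ∀ y ∈ D.pointSet s, ∀ R : ℝ, 2 ≤ R →
      |D.freqEstimate P (patchClass P s₀ y₀) s y R - ξ| ≤
        (S.card + 1) ^ (m - 1) * (C * Real.log R ^ p) / R ^ d := by
    intro s hs y hy R hR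
    have hR0 : 0 ≤ R := by linarith
    have hN : (0 : ℝ) < (2 * (⌊R⌋₊ : ℝ) + 1) ^ d := by positivity
    have hlog : 0 ≤ Real.log R := Real.log_nonneg (by linarith)
    rw [freqEstimate_eq hP hs hy hs₀ hy₀ hR0, div_sub' hN.ne', abs_div, abs_of_pos hN]
    refine div_le_div₀ (by positivity) (hξ R hR _) (by positivity) ?_
    gcongr
    have := Nat.lt_floor_add_one R
    linarith [(Nat.cast_nonneg ⌊R⌋₊ : (0 : ℝ) ≤ _)]
  have hfreq : D.HasFrequency P (patchClass P s₀ y₀) ξ := by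
    intro s hs y hy
    rw [tendsto_iff_norm_sub_tendsto_zero]
    have hlim : Tendsto (fun R : ℝ => ((S.card : ℝ) + 1) ^ (m - 1) * (C * Real.log R ^ p) / R ^ d)
        atTop (𝓝 0) := by
      have h1 := (isLittleO_log_rpow_rpow_atTop p
        (by exact_mod_cast hd : (0 : ℝ) < (d : ℝ))).tendsto_div_nhds_zero
      have h2 := h1.const_mul (((S.card : ℝ) + 1) ^ (m - 1) * C)
      rw [mul_zero] at h2
      refine h2.congr fun R => ?_
      rw [Real.rpow_natCast]; ring
    refine squeeze_zero' (Eventually.of_forall fun _ => norm_nonneg _) ?_ hlim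
    filter_upwards [eventually_ge_atTop 2] with R hR
    exact bound s hs y hy R hR
  have hξ0 : 0 ≤ ξ := ge_of_tendsto (hfreq s₀ hs₀ y₀ hy₀) <| by
    filter_upwards [eventually_ge_atTop 0] with R hR
    exact (freqEstimate_mem_Icc hP hs₀ hy₀ hs₀ hy₀ hR).1
  have hξ1 : ξ ≤ 1 := le_of_tendsto (hfreq s₀ hs₀ y₀ hy₀) <| by
    filter_upwards [eventually_ge_atTop 0] with R hR
    exact (freqEstimate_mem_Icc hP hs₀ hy₀ hs₀ hy₀ hR).2
  refine ⟨ξ, hfreq, fun s hs y hy R hR => ⟨bound s hs y hy R hR, ?_⟩⟩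
  have := freqEstimate_mem_Icc hP hs hy hs₀ hy₀ (by linarith : 0 ≤ R)
  rw [abs_le]
  exact ⟨by linarith [this.1], by linarith [this.2]⟩

end CubicalScheme

end CutProject

/-! ### Lattice points near the boundary of a convex body -/

namespace CutProject

variable {d m : ℕ}

/-- The integer points whose `c`-neighbourhood meets `K` but is not contained in it. -/
def nearBoundary (K : Set (Fin d → ℝ)) (c : ℝ) : Set (Fin d → ℤ) :=
  {n | (∃ x ∈ K, x ∈ Metric.closedBall (fun j => (n j : ℝ)) c) ∧
    ¬ Metric.closedBall (fun j => (n j : ℝ)) c ⊆ K}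

theorem finite_nearBoundary {K : Set (Fin d → ℝ)} (hK : Bornology.IsBounded K) (c : ℝ) :
    (nearBoundary K c).Finite := by
  obtain ⟨B, hB⟩ := hK.exists_norm_le
  refine (intCube d ⌈B + c⌉₊).finite_toSet.subset ?_
  rintro n ⟨⟨x, hx, hxn⟩, -⟩
  rw [Finset.mem_coe, Fintype.mem_piFinset]
  intro i
  have h1 := hB x hx
  rw [Metric.mem_closedBall, dist_comm, dist_eq_norm] at hxn
  have h2 : ‖(fun j => (n j : ℝ))‖ ≤ B + c := by
    have := norm_le_norm_add_norm_sub' (fun j => (n j : ℝ)) x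
    linarith
  have h3 := (norm_le_pi_norm (fun j => (n j : ℝ)) i).trans (h2.trans (Nat.le_ceil _))
  rw [Real.norm_eq_abs] at h3
  rw [Finset.mem_Icc]
  have := abs_le.1 h3
  exact ⟨by exact_mod_cast this.1, by exact_mod_cast this.2⟩

theorem one_add_pow_sub_one_sub_pow_le {t : ℝ} (h0 : 0 ≤ t) (h1 : t ≤ 1) (d : ℕ) :
    (1 + t) ^ d - (1 - t) ^ d ≤ d * 2 ^ d * t := by
  induction d with
  | zero => simp
  | succ d ih =>
    have hb : (1 - t) ^ d ≤ 1 := pow_le_one₀ (by linarith) (by linarith)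
    have h2 : (1 : ℝ) ≤ 2 ^ d := one_le_pow₀ one_le_two
    have e : (1 + t) ^ (d + 1) - (1 - t) ^ (d + 1) =
        (1 + t) * ((1 + t) ^ d - (1 - t) ^ d) + 2 * t * (1 - t) ^ d := by ring
    have h3 : (1 + t) * ((1 + t) ^ d - (1 - t) ^ d) ≤ 2 * (d * 2 ^ d * t) := by
      have hnn : (1 - t) ^ d ≤ (1 + t) ^ d := pow_le_pow_left₀ (by linarith) (by linarith) d
      exact mul_le_mul (by linarith) ih (by linarith) (by norm_num)
    have h4 : 2 * t * (1 - t) ^ d ≤ 2 * t * 2 ^ d := by gcongr; linarith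
    rw [e, pow_succ]
    push_cast
    linarith

theorem disjoint_ball_intCast {n n' : Fin d → ℤ} (h : n ≠ n') :
    Disjoint (Metric.ball (fun j => (n j : ℝ)) (1 / 2)) (Metric.ball (fun j => (n' j : ℝ)) (1 / 2)) := by
  refine Metric.ball_disjoint_ball ?_
  obtain ⟨i, hi⟩ := Function.ne_iff.1 h
  have h1 := dist_le_pi_dist (fun j => (n j : ℝ)) (fun j => (n' j : ℝ)) i
  have h2 : (1 : ℝ) ≤ dist (n i : ℝ) (n' i : ℝ) := by
    rw [Real.dist_eq]
    exact_mod_cast Int.one_le_abs (sub_ne_zero.2 hi)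
  linarith

/-- The number of integer points near the boundary of a dilated convex body. -/
theorem exists_card_nearBoundary_le (hd : 0 < d) {Ω : Set (Fin d → ℝ)}
    (hb : Bornology.IsBounded Ω) (hc : Convex ℝ Ω) (h0 : Ω ∈ 𝓝 0) {c : ℝ} (hc0 : 0 ≤ c) :
    ∃ A r₀ : ℝ, 0 ≤ A ∧ 1 ≤ r₀ ∧ ∀ r : ℝ, r₀ ≤ r → ∃ S : Finset (Fin d → ℤ),
      nearBoundary (r • Ω) c ⊆ S ∧ (S.card : ℝ) ≤ A * r ^ (d - 1) := by
  obtain ⟨ρ, hρ, hball⟩ := Metric.nhds_basis_closedBall.mem_iff.1 h0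
  -- The extra 1/2 makes room for the unit cube around each integer point.
  set c' := c + 1 / 2 with hc'
  have hc'0 : 0 < c' := by positivity
  set V := (volume Ω).toReal with hV
  have hVtop : volume Ω ≠ ⊤ := hb.measure_lt_top.ne
  refine ⟨V * (d * 2 ^ d) * (c' / ρ), max 1 (c' / ρ), by positivity, le_max_left _ _, ?_⟩
  intro r hr
  have hr1 : 1 ≤ r := (le_max_left _ _).trans hr
  have hr2 : c' / ρ ≤ r := (le_max_right _ _).trans hr
  have hr0 : 0 < r := by linarith
  set K := r • Ω with hK
  have hKb : Bornology.IsBounded K := hb.smul₀ r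
  have hKc : Convex ℝ K := hc.smul r
  have hfin := finite_nearBoundary hKb c
  refine ⟨hfin.toFinset, by simp, ?_⟩
  set S := hfin.toFinset with hS
  set t := c' / ρ / r with ht
  have ht0 : 0 < t := by positivity
  have ht1 : t ≤ 1 := by rw [ht, div_le_one hr0]; exact hr2
  have htr : t * r = c' / ρ := by rw [ht]; field_simp
  -- With t of order 1/r, vectors of norm at most c' lie in tK. By convexity aK + bK = (a + b)K, so
  -- the cubes around points of S lie in (1 + t)K and avoid (1 - t)K.
  have hsmall : ∀ u : Fin d → ℝ, ‖u‖ ≤ c' → u ∈ t • K := by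
    intro u hu
    rw [hK, smul_smul, htr]
    have hpos : 0 < c' / ρ := by positivity
    rw [Set.mem_smul_set_iff_inv_smul_mem₀ hpos.ne']
    refine hball ?_
    rw [mem_closedBall_zero_iff, norm_smul, norm_inv, Real.norm_eq_abs, abs_of_pos hpos,
      inv_mul_le_iff₀ hpos]
    calc ‖u‖ ≤ c' := hu
      _ = c' / ρ * ρ := by field_simp
  have hin : ∀ n ∈ S, Metric.ball (fun j => (n j : ℝ)) (1 / 2) ⊆ (1 + t) • K := by
    intro n hn x hx
    obtain ⟨⟨k, hk, hkn⟩, -⟩ := hfin.mem_toFinset.1 hn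
    rw [hKc.add_smul zero_le_one ht0.le, one_smul]
    refine ⟨k, hk, x - k, hsmall _ ?_, by simp⟩
    rw [← dist_eq_norm]
    rw [Metric.mem_ball] at hx
    rw [Metric.mem_closedBall, dist_comm] at hkn
    have := dist_triangle x (fun j => (n j : ℝ)) k
    linarith
  have hout : ∀ n ∈ S, Disjoint (Metric.ball (fun j => (n j : ℝ)) (1 / 2)) ((1 - t) • K) := by
    intro n hn
    rw [Set.disjoint_left]
    intro x hx hxK
    obtain ⟨-, hnot⟩ := hfin.mem_toFinset.1 hn
    refine hnot fun q hq => ?_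
    have e : K = (1 - t) • K + t • K := by
      rw [← hKc.add_smul (by linarith) ht0.le, sub_add_cancel, one_smul]
    rw [e]
    refine ⟨x, hxK, q - x, hsmall _ ?_, by simp⟩
    rw [← dist_eq_norm]
    rw [Metric.mem_ball, dist_comm] at hx
    rw [Metric.mem_closedBall] at hq
    have := dist_triangle q (fun j => (n j : ℝ)) x
    linarith
  -- In the sup norm, balls of radius 1/2 are unit cubes, so the volume of the union counts the
  -- points of S.
  have hvol : volume (⋃ n ∈ S, Metric.ball (fun j => (n j : ℝ)) (1 / 2)) = (S.card : ENNReal) := by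
    rw [measure_biUnion_finset (fun n _ n' _ h => disjoint_ball_intCast h)
      fun n _ => Metric.isOpen_ball.measurableSet]
    simp [Real.volume_pi_ball]
  have hscale : ∀ u : ℝ, 0 ≤ u → volume (u • K) = ENNReal.ofReal ((u * r) ^ d * V) := by
    intro u hu
    rw [hK, smul_smul, Measure.addHaar_smul, Module.finrank_fin_fun,
      abs_of_nonneg (by positivity), ENNReal.ofReal_mul (by positivity), ENNReal.ofReal_toReal hVtop]
  have hmeas : (S.card : ENNReal) + volume ((1 - t) • K) ≤ volume ((1 + t) • K) := by
    rw [← hvol, ← measure_union' ?_ (Finset.measurableSet_biUnion _ fun n _ =>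
      Metric.isOpen_ball.measurableSet)]
    · refine measure_mono (Set.union_subset (Set.iUnion₂_subset hin) ?_)
      intro x hx
      have e : (1 + t) • K = (1 - t) • K + (2 * t) • K := by
        rw [← hKc.add_smul (by linarith) (by linarith)]
        congr 1; ring
      rw [e]
      refine ⟨x, hx, 0, ⟨0, ?_, by simp⟩, by simp⟩
      exact ⟨0, mem_of_mem_nhds h0, by simp⟩
    · exact Set.disjoint_iUnion₂_left.2 hout
  rw [hscale _ (by linarith), hscale _ (by linarith), ← ENNReal.ofReal_natCast,
    ← ENNReal.ofReal_add (by positivity) (by have : 0 ≤ 1 - t := by linarith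
                                             positivity),
    ENNReal.ofReal_le_ofReal_iff (by positivity)] at hmeas
  have hpow := one_add_pow_sub_one_sub_pow_le ht0.le ht1 d
  rw [mul_pow, mul_pow] at hmeas
  have hrd : r ^ d = r ^ (d - 1) * r := by
    rw [← pow_succ]; congr 1; omega
  calc (S.card : ℝ) ≤ ((1 + t) ^ d - (1 - t) ^ d) * (r ^ d * V) := by linarith
    _ ≤ (d * 2 ^ d * t) * (r ^ d * V) := by gcongr
    _ = V * (d * 2 ^ d) * (t * r) * r ^ (d - 1) := by rw [hrd]; ring
    _ = _ := by rw [htr]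

theorem card_Icc_ceil_floor_le {a c : ℝ} (hc : 0 ≤ c) :
    ((Finset.Icc ⌈a - c⌉ ⌊a + c⌋).card : ℝ) ≤ 2 * c + 1 := by
  rw [Int.card_Icc]
  have h1 := Int.floor_le (a + c)
  have h2 := Int.le_ceil (a - c)
  rcases le_or_gt 0 (⌊a + c⌋ + 1 - ⌈a - c⌉) with h | h
  · have : (((⌊a + c⌋ + 1 - ⌈a - c⌉).toNat : ℤ) : ℝ) = ((⌊a + c⌋ + 1 - ⌈a - c⌉ : ℤ) : ℝ) := by
      rw [Int.toNat_of_nonneg h]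
    rw [Int.cast_natCast] at this
    rw [this]; push_cast; linarith
  · rw [Int.toNat_of_nonpos h.le]; push_cast; linarith

/-- In dimension one, the number of integer points near the boundary is bounded independently of
the interval. -/
theorem exists_card_nearBoundary_one_le {K : Set (Fin 1 → ℝ)} (hb : Bornology.IsBounded K)
    (hc : Convex ℝ K) {c : ℝ} (hc0 : 0 ≤ c) :
    ∃ S : Finset (Fin 1 → ℤ), nearBoundary K c ⊆ S ∧ (S.card : ℝ) ≤ 2 * (2 * c + 1) := by
  classical
  set J : Set ℝ := (fun x : Fin 1 → ℝ => x 0) '' K with hJ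
  have hJb : Bornology.IsBounded J := by
    obtain ⟨B, hB⟩ := hb.exists_norm_le
    refine isBounded_iff_forall_norm_le.2 ⟨B, ?_⟩
    rintro _ ⟨x, hx, rfl⟩
    exact (norm_le_pi_norm x 0).trans (hB x hx)
  have hJc : J.OrdConnected := by
    have : Convex ℝ J := hc.linear_image (LinearMap.proj (R := ℝ) (φ := fun _ : Fin 1 => ℝ) 0)
    exact this.ordConnected
  have hJK : ∀ x : Fin 1 → ℝ, x 0 ∈ J → x ∈ K := by
    rintro x ⟨y, hy, hyx⟩
    have : x = y := by
      funext i
      rw [Subsingleton.elim i 0]; exact hyx.symm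
    rwa [this]
  set a := sInf J
  set b := sSup J
  refine ⟨(Finset.Icc ⌈a - c⌉ ⌊a + c⌋ ∪ Finset.Icc ⌈b - c⌉ ⌊b + c⌋).image fun z _ => z, ?_, ?_⟩
  · rintro n ⟨⟨x, hx, hxn⟩, hnot⟩
    rw [Finset.mem_coe, Finset.mem_image]
    refine ⟨n 0, ?_, by funext i; rw [Subsingleton.elim i 0]⟩
    have hxJ : x 0 ∈ J := ⟨x, hx, rfl⟩
    have h1 : a ≤ x 0 := csInf_le hJb.bddBelow hxJ
    have h2 : x 0 ≤ b := le_csSup hJb.bddAbove hxJ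
    have h3 : |x 0 - n 0| ≤ c := by
      have := (dist_le_pi_dist x (fun j => (n j : ℝ)) 0).trans (Metric.mem_closedBall.1 hxn)
      rwa [Real.dist_eq] at this
    rw [abs_le] at h3
    rw [Finset.mem_union, Finset.mem_Icc, Finset.mem_Icc, Int.ceil_le, Int.le_floor, Int.ceil_le,
      Int.le_floor]
    -- An integer farther than c from both ends of the interval has its whole c-ball inside, so it
    -- is not near the boundary.
    by_contra hcon
    push Not at hcon
    have h4 := hcon.1 (by linarith)
    have h5 : (n 0 : ℝ) < b - c := by
      by_contra h
      have := hcon.2 (by linarith)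
      linarith
    refine hnot fun q hq => hJK q ?_
    have h6 : |q 0 - n 0| ≤ c := by
      have := (dist_le_pi_dist q (fun j => (n j : ℝ)) 0).trans (Metric.mem_closedBall.1 hq)
      rwa [Real.dist_eq] at this
    rw [abs_le] at h6
    obtain ⟨y, hy, hyq⟩ := exists_lt_of_csInf_lt ⟨_, hxJ⟩ (show a < q 0 by linarith)
    obtain ⟨z, hz, hqz⟩ := exists_lt_of_lt_csSup ⟨_, hxJ⟩ (show q 0 < b by linarith)
    exact hJc.out hy hz ⟨hyq.le, hqz.le⟩
  · have h1 := Finset.card_image_le (s := Finset.Icc ⌈a - c⌉ ⌊a + c⌋ ∪ Finset.Icc ⌈b - c⌉ ⌊b + c⌋)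
      (f := fun (z : ℤ) (_ : Fin 1) => z)
    have h2 := h1.trans (Finset.card_union_le _ _)
    have h3 : (((Finset.Icc ⌈a - c⌉ ⌊a + c⌋ ∪ Finset.Icc ⌈b - c⌉ ⌊b + c⌋).image
        fun (z : ℤ) (_ : Fin 1) => z).card : ℝ) ≤
        ((Finset.Icc ⌈a - c⌉ ⌊a + c⌋).card : ℝ) + ((Finset.Icc ⌈b - c⌉ ⌊b + c⌋).card : ℝ) := by
      exact_mod_cast h2
    have h4 := card_Icc_ceil_floor_le (a := a) hc0
    have h5 := card_Icc_ceil_floor_le (a := b) hc0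
    linarith

/-! ### Which displacements can enter or leave a patch -/

variable {α : Fin m → Fin d → ℝ}

/-- The parametrisation `x ↦ (x, L x)` of the physical space. -/
noncomputable def graphMap (α : Fin m → Fin d → ℝ) : (Fin d → ℝ) →ₗ[ℝ] TotalSpace d m :=
  LinearMap.prod LinearMap.id (linMap α)

theorem graphMap_fst {v : TotalSpace d m} (hv : v ∈ physicalSpace α) : graphMap α v.1 = v := by
  rw [physicalSpace, LinearMap.mem_graph_iff] at hv
  exact Prod.ext rfl hv.symm

theorem preimage_graphMap_smul (Ω : Set (TotalSpace d m)) {r : ℝ} (hr : r ≠ 0) :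
    graphMap α ⁻¹' (r • Ω) = r • (graphMap α ⁻¹' Ω) := by
  ext x
  rw [Set.mem_preimage, Set.mem_smul_set_iff_inv_smul_mem₀ hr,
    Set.mem_smul_set_iff_inv_smul_mem₀ hr, Set.mem_preimage, map_smul]

theorem IsPatchShape.isBounded_preimage {Ω : Set (TotalSpace d m)} (h : IsPatchShape α Ω) :
    Bornology.IsBounded (graphMap α ⁻¹' Ω) := by
  obtain ⟨B, hB⟩ := h.bounded.exists_norm_le
  refine isBounded_iff_forall_norm_le.2 ⟨B, fun x hx => ?_⟩
  exact (norm_fst_le (graphMap α x)).trans (hB _ hx)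

theorem IsPatchShape.preimage_mem_nhds {Ω : Set (TotalSpace d m)} (h : IsPatchShape α Ω) :
    graphMap α ⁻¹' Ω ∈ 𝓝 0 := by
  have hc : Continuous (graphMap α) := LinearMap.continuous_of_finiteDimensional _
  have ht : Tendsto (graphMap α) (𝓝 0) (𝓝[(physicalSpace α : Set (TotalSpace d m))] 0) := by
    refine tendsto_nhdsWithin_of_tendsto_nhds_of_eventually_within _ ?_
      (Eventually.of_forall fun x => ?_)
    · simpa using hc.tendsto 0
    · simp [graphMap, physicalSpace, LinearMap.mem_graph_iff]
  exact ht h.nhds_zero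

theorem rho_intVec (α : Fin m → Fin d → ℝ) (n : Fin d → ℤ) (z z' : Fin m → ℤ) :
    rho α (intVec n z) = rho α (intVec n z') := by
  rw [← sub_eq_zero, ← map_sub, rho, Submodule.projection_apply_eq_zero_iff]
  simp [referenceSpace, intVec]

namespace CubicalScheme

/-- ρ ignores the last m coordinates, so membership depends on n alone and there are no exceptional
frequencies. -/
theorem isDeterminedOff_rho (A : Set (TotalSpace d m)) :
    IsDeterminedOff α (floorCond fun u => rho α u ∈ A) ∅ := by
  intro n _ w _ w' _ h
  simp only [floorCond] at h ⊢
  rwa [rho_intVec α n _ (-phaseFloor α w n)]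

/-- Split the displacement as (n, L n) plus (0, internal coordinate). π fixes the first summand, and
the second is bounded because it is a difference of points of [0,1)^m. The constant c depends on π
but not on the patch shape. -/
theorem exists_norm_proj_sub_le (D : CubicalScheme α) : ∃ c : ℝ, 0 ≤ c ∧
    ∀ w ∈ unitCube m, ∀ n : Fin d → ℤ,
      ‖(D.proj (intVec n (-phaseFloor α w n))).1 - fun j => (n j : ℝ)‖ ≤ c := by
  let f : (Fin m → ℝ) →ₗ[ℝ] (Fin d → ℝ) :=
    LinearMap.fst ℝ _ _ ∘ₗ D.proj ∘ₗ LinearMap.inr ℝ (Fin d → ℝ) (Fin m → ℝ)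
  let F := LinearMap.toContinuousLinearMap f
  refine ⟨‖F‖, norm_nonneg _, fun w hw n => ?_⟩
  set u : TotalSpace d m := intVec n (-phaseFloor α w n) with hu
  have hdecomp : u = graphMap α (fun j => (n j : ℝ)) + (0, internalCoord α u) := by
    ext <;> simp [graphMap, internalCoord, hu, intVec]
  have hgr : D.proj (graphMap α (fun j => (n j : ℝ))) = graphMap α (fun j => (n j : ℝ)) := by
    refine Submodule.projection_apply_of_mem_left D.isCompl ?_
    simp [graphMap, physicalSpace, LinearMap.mem_graph_iff]
  have hcoord : ‖internalCoord α u‖ ≤ 1 := by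
    refine (pi_norm_le_iff_of_nonneg zero_le_one).2 fun i => ?_
    have h1 : internalCoord α u i = Int.fract (w i - phase α n i) - w i := by
      rw [hu, internalCoord_intVec, Int.fract]
      simp only [Pi.neg_apply, phaseFloor]
      push_cast; ring
    have h2 := Int.fract_nonneg (w i - phase α n i)
    have h3 := Int.fract_lt_one (w i - phase α n i)
    rw [h1, Real.norm_eq_abs, abs_le]
    constructor <;> linarith [(hw i).1, (hw i).2]
  have hproj : (D.proj u).1 - (fun j => (n j : ℝ)) = F (internalCoord α u) := by
    conv_lhs => rw [hdecomp, map_add, hgr]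
    show ((fun j => (n j : ℝ)) + (D.proj (0, internalCoord α u)).1) - (fun j => (n j : ℝ)) =
      (D.proj (0, internalCoord α u)).1
    abel
  rw [hproj]
  calc ‖F (internalCoord α u)‖ ≤ ‖F‖ * ‖internalCoord α u‖ := F.le_opNorm _
    _ ≤ ‖F‖ * 1 := by gcongr
    _ = ‖F‖ := mul_one _

/-- Off S, the c-ball around n either misses the shape or lies inside it, and all the projected
displacements over n lie in that ball. -/
theorem isDeterminedOff_proj (D : CubicalScheme α) {c : ℝ}
    (hc : ∀ w ∈ unitCube m, ∀ n : Fin d → ℤ,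
      ‖(D.proj (intVec n (-phaseFloor α w n))).1 - fun j => (n j : ℝ)‖ ≤ c)
    {A : Set (TotalSpace d m)} {S : Finset (Fin d → ℤ)}
    (hS : nearBoundary (graphMap α ⁻¹' A) c ⊆ S) :
    IsDeterminedOff α (floorCond fun u => D.proj u ∈ A) S := by
  have hiff : ∀ u, D.proj u ∈ A ↔ (D.proj u).1 ∈ graphMap α ⁻¹' A := by
    intro u
    rw [Set.mem_preimage, graphMap_fst (D.proj_mem u)]
  intro n hn w hw w' hw' h
  simp only [floorCond] at h ⊢
  rw [hiff] at h ⊢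
  by_contra hcon
  refine hn (hS ⟨⟨_, h, ?_⟩, fun hsub => hcon (hsub ?_)⟩)
  · rw [Metric.mem_closedBall, dist_eq_norm]; exact hc w hw n
  · rw [Metric.mem_closedBall, dist_eq_norm]; exact hc w' hw' n

end CubicalScheme

end CutProject

/-! ### Making the constant uniform in the shape -/

namespace CutProject

variable {d m : ℕ} {α : Fin m → Fin d → ℝ}

/-- The frequencies of the patches of shape `Ω` converge at a rate that is uniform in the shape. -/
def CubicalScheme.HasUniformFrequencies (D : CubicalScheme α) (q C : ℝ) : Prop :=
  ∀ Ω : Set (TotalSpace d m), IsPatchShape α Ω →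
    (∀ r : ℝ, 0 < r → ∀ s, D.IsRegular s → ∀ y' ∈ D.pointSet s, ∃ ξ : ℝ,
      D.HasFrequency (D.patchII (r • Ω)) (patchClass (D.patchII (r • Ω)) s y') ξ ∧
      ∀ s₁, D.IsRegular s₁ → ∀ y ∈ D.pointSet s₁, ∀ R : ℝ, 2 ≤ R →
        |D.freqEstimate (D.patchII (r • Ω)) (patchClass (D.patchII (r • Ω)) s y') s₁ y R - ξ|
          ≤ C * (Real.log R ^ q / R ^ d)) ∧
    (∃ r₀ : ℝ, 0 < r₀ ∧
      ∀ r : ℝ, r₀ ≤ r → ∀ s, D.IsRegular s → ∀ y' ∈ D.pointSet s, ∃ ξ : ℝ,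
      D.HasFrequency (D.patchI (r • Ω)) (patchClass (D.patchI (r • Ω)) s y') ξ ∧
      ∀ s₁, D.IsRegular s₁ → ∀ y ∈ D.pointSet s₁, ∀ R : ℝ, 2 ≤ R →
        |D.freqEstimate (D.patchI (r • Ω)) (patchClass (D.patchI (r • Ω)) s y') s₁ y R - ξ|
          ≤ C * (Real.log R ^ q * r ^ ((d - 1) * (m - 1)) / R ^ d))

theorem exists_le_log_rpow {η : ℝ} (hη : 0 < η) (G : ℝ) :
    ∃ R₀ : ℝ, 2 ≤ R₀ ∧ ∀ R, R₀ ≤ R → G ≤ Real.log R ^ η := by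
  have h := ((tendsto_rpow_atTop hη).comp Real.tendsto_log_atTop).eventually_ge_atTop G
  obtain ⟨R₀, h0⟩ := eventually_atTop.1 h
  exact ⟨max 2 R₀, le_max_left _ _, fun R hR => h0 R ((le_max_right _ _).trans hR)⟩

/-- A sub-optimal power of the logarithm absorbs a constant, at the expense of small `R`, for which
the trivial bound suffices. -/
theorem exists_forall_min_le {p η C₀ G : ℝ} (hp : 0 < p) (hη : 0 < η) (hC₀ : 0 ≤ C₀) (d : ℕ)
    {e : ℕ} (he : e ≠ 0) :
    ∃ r₀ : ℝ, 1 ≤ r₀ ∧ ∀ r : ℝ, r₀ ≤ r → ∀ R : ℝ, 2 ≤ R → ∀ x : ℝ, x ≤ 1 →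
      x ≤ G * r ^ e * (C₀ * Real.log R ^ p) / R ^ d →
      x ≤ (C₀ + (Real.log 2 ^ (p + η))⁻¹) * (Real.log R ^ (p + η) * r ^ e / R ^ d) := by
  have hl2 := Real.log_pos (one_lt_two (α := ℝ))
  obtain ⟨R₀, hR₀, hlog⟩ := exists_le_log_rpow hη G
  -- For R < R₀ this threshold gives R^d ≤ R₀^d ≤ r ≤ r^e, the last step using e ≠ 0. The claimed
  -- bound is then at least 1, and x ≤ 1 suffices.
  refine ⟨R₀ ^ d, one_le_pow₀ (by linarith), fun r hr R hR x hx1 hx => ?_⟩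
  have hr1 : 1 ≤ r := le_trans (one_le_pow₀ (by linarith)) hr
  have hR0 : 0 < R := by linarith
  have hlR : Real.log 2 ≤ Real.log R := Real.log_le_log (by norm_num) hR
  have hlR0 : 0 < Real.log R := by linarith
  have hsplit : Real.log R ^ (p + η) = Real.log R ^ p * Real.log R ^ η := Real.rpow_add hlR0 _ _
  have hnn : 0 ≤ Real.log R ^ (p + η) * r ^ e / R ^ d := by positivity
  have hinv : 0 < (Real.log 2 ^ (p + η))⁻¹ := by positivity
  rw [add_mul]
  rcases le_or_gt R₀ R with h | h
  · have h1 : G * r ^ e * (C₀ * Real.log R ^ p) / R ^ d ≤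
        C₀ * (Real.log R ^ (p + η) * r ^ e / R ^ d) := by
      rw [hsplit, ← mul_div_assoc]
      refine div_le_div_of_nonneg_right ?_ (by positivity)
      calc G * r ^ e * (C₀ * Real.log R ^ p) ≤
          Real.log R ^ η * r ^ e * (C₀ * Real.log R ^ p) := by gcongr; exact hlog R h
        _ = _ := by ring
    have := mul_nonneg hinv.le hnn
    linarith
  · have h1 : R ^ d ≤ r ^ e := by
      calc R ^ d ≤ R₀ ^ d := by gcongr
        _ ≤ r := hr
        _ ≤ r ^ e := le_self_pow₀ hr1 he
    have h2 : Real.log 2 ^ (p + η) ≤ Real.log R ^ (p + η) :=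
      Real.rpow_le_rpow hl2.le hlR (by linarith)
    have h3 : 1 ≤ (Real.log 2 ^ (p + η))⁻¹ * (Real.log R ^ (p + η) * r ^ e / R ^ d) := by
      rw [inv_mul_eq_div, le_div_iff₀ (by positivity), one_mul, le_div_iff₀ (by positivity)]
      gcongr
    have := mul_nonneg hC₀ hnn
    linarith

theorem log_rpow_le {p η R : ℝ} (hη : 0 < η) (hR : 2 ≤ R) :
    Real.log R ^ p ≤ (Real.log 2 ^ η)⁻¹ * Real.log R ^ (p + η) := by
  have hl2 := Real.log_pos (one_lt_two (α := ℝ))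
  have hlR : Real.log 2 ≤ Real.log R := Real.log_le_log (by norm_num) hR
  have hlR0 : 0 < Real.log R := by linarith
  rw [Real.rpow_add hlR0, inv_mul_eq_div, le_div_iff₀ (by positivity)]
  gcongr

theorem exists_hasUniformFrequencies (hd : 0 < d) (hm : 0 < m) {p η C₀ : ℝ} (hp : 0 < p)
    (hη : 0 < η) (hC₀ : 0 < C₀) (hα : HasSmallDiscrepancy α p C₀) (D : CubicalScheme α) :
    ∃ C : ℝ, 0 < C ∧ D.HasUniformFrequencies (p + η) C := by
  have hl2 := Real.log_pos (one_lt_two (α := ℝ))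
  obtain ⟨c, hc0, hc⟩ := D.exists_norm_proj_sub_le
  set B : ℝ := (2 * (2 * c + 1) + 1) ^ (m - 1) with hB
  have hB1 : 1 ≤ B := one_le_pow₀ (by linarith)
  set C₁ : ℝ := B * (C₀ * (Real.log 2 ^ η)⁻¹) with hC₁
  set C₂ : ℝ := C₀ + (Real.log 2 ^ (p + η))⁻¹ with hC₂
  have hC₁0 : 0 < C₁ := by positivity
  have hC₂0 : 0 < C₂ := by positivity
  have hsimple : ∀ N : ℝ, 0 ≤ N → N ≤ B → ∀ R : ℝ, 2 ≤ R →
      N * (C₀ * Real.log R ^ p) / R ^ d ≤ (C₁ + C₂) * (Real.log R ^ (p + η) / R ^ d) := by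
    intro N hN0 hN R hR
    have hlR0 : 0 ≤ Real.log R := Real.log_nonneg (by linarith)
    have hR0 : 0 < R := by linarith
    rw [← mul_div_assoc]
    refine div_le_div_of_nonneg_right ?_ (by positivity)
    calc N * (C₀ * Real.log R ^ p) ≤
        B * (C₀ * ((Real.log 2 ^ η)⁻¹ * Real.log R ^ (p + η))) := by
          gcongr; exact log_rpow_le hη hR
      _ = C₁ * Real.log R ^ (p + η) := by rw [hC₁]; ring
      _ ≤ (C₁ + C₂) * Real.log R ^ (p + η) := by gcongr; linarith
  refine ⟨C₁ + C₂, by positivity, fun Ω hΩ => ⟨fun r hr s hs y' hy' => ?_, ?_⟩⟩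
  · obtain ⟨ξ, h1, h2⟩ := CubicalScheme.exists_hasFrequency hα hd hm hC₀.le
      (D.isPatchBy_patchII (r • Ω)) (CubicalScheme.isDeterminedOff_rho (r • Ω)) hs hy'
    refine ⟨ξ, h1, fun s₁ hs₁ y hy R hR => (h2 s₁ hs₁ y hy R hR).1.trans ?_⟩
    refine hsimple _ (by positivity) ?_ R hR
    simpa using hB1
  · set Ω₀ := graphMap α ⁻¹' Ω with hΩ₀
    have hΩ₀c : Convex ℝ Ω₀ := hΩ.convex.linear_preimage (graphMap α)
    by_cases he : (d - 1) * (m - 1) = 0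
    · have hS : ∃ r₀ : ℝ, 0 < r₀ ∧ ∀ r, r₀ ≤ r → ∃ S : Finset (Fin d → ℤ),
          nearBoundary (r • Ω₀) c ⊆ S ∧ ((S.card : ℝ) + 1) ^ (m - 1) ≤ B := by
        rcases Nat.mul_eq_zero.1 he with h | h
        · obtain rfl : d = 1 := by omega
          refine ⟨1, one_pos, fun r _ => ?_⟩
          obtain ⟨S, hS1, hS2⟩ := exists_card_nearBoundary_one_le
            (hΩ.isBounded_preimage.smul₀ r) (hΩ₀c.smul r) hc0
          refine ⟨S, hS1, ?_⟩
          rw [hB]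
          gcongr
        · refine ⟨1, one_pos, fun r _ => ?_⟩
          refine ⟨(finite_nearBoundary (hΩ.isBounded_preimage.smul₀ r) c).toFinset,
            (Set.Finite.coe_toFinset _).ge, ?_⟩
          rw [h, pow_zero]
          exact hB1
      obtain ⟨r₀, hr₀, hS⟩ := hS
      refine ⟨r₀, hr₀, fun r hr s hs y' hy' => ?_⟩
      obtain ⟨S, hS1, hS2⟩ := hS r hr
      rw [← preimage_graphMap_smul Ω (by linarith : r ≠ 0)] at hS1
      obtain ⟨ξ, h1, h2⟩ := CubicalScheme.exists_hasFrequency hα hd hm hC₀.le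
        (D.isPatchBy_patchI (r • Ω)) (D.isDeterminedOff_proj hc hS1) hs hy'
      refine ⟨ξ, h1, fun s₁ hs₁ y hy R hR => (h2 s₁ hs₁ y hy R hR).1.trans ?_⟩
      rw [he, pow_zero, mul_one]
      exact hsimple _ (by positivity) hS2 R hR
    · obtain ⟨A, r₁, hA, hr₁, hS⟩ := exists_card_nearBoundary_le hd hΩ.isBounded_preimage hΩ₀c
        hΩ.preimage_mem_nhds hc0
      obtain ⟨r₂, hr₂, hmin⟩ := exists_forall_min_le (G := (A + 1) ^ (m - 1)) hp hη hC₀.le d he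
      refine ⟨max r₁ r₂, by positivity, fun r hr s hs y' hy' => ?_⟩
      have hrr₁ : r₁ ≤ r := (le_max_left _ _).trans hr
      have hrr₂ : r₂ ≤ r := (le_max_right _ _).trans hr
      have hr1 : 1 ≤ r := hr₁.trans hrr₁
      obtain ⟨S, hS1, hS2⟩ := hS r hrr₁
      rw [← preimage_graphMap_smul Ω (by linarith : r ≠ 0)] at hS1
      obtain ⟨ξ, h1, h2⟩ := CubicalScheme.exists_hasFrequency hα hd hm hC₀.le
        (D.isPatchBy_patchI (r • Ω)) (D.isDeterminedOff_proj hc hS1) hs hy'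
      refine ⟨ξ, h1, fun s₁ hs₁ y hy R hR => ?_⟩
      obtain ⟨h3, h4⟩ := h2 s₁ hs₁ y hy R hR
      have hlR0 : 0 ≤ Real.log R := Real.log_nonneg (by linarith)
      have hR0 : 0 < R := by linarith
      refine (hmin r hrr₂ R hR _ h4 (h3.trans ?_)).trans ?_
      · gcongr
        -- The number of cells is at most (A r^(d-1) + 1)^(m-1) ≤ ((A + 1) r^(d-1))^(m-1).
        rw [pow_mul, ← mul_pow]
        gcongr
        have : 1 ≤ r ^ (d - 1) := one_le_pow₀ hr1
        linarith
      · exact mul_le_mul_of_nonneg_right (le_add_of_nonneg_left hC₁0.le) (by positivity)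

end CutProject

theorem theorem4 (k d : ℕ) (hd : 0 < d) (hdk : d < k) (ε : ℝ) (hε : 0 < ε) :
    ∀ᵐ α : Fin (k - d) → Fin d → ℝ, ∀ D : CutProject.CubicalScheme α, ∃ C : ℝ, 0 < C ∧
      ∀ Ω : Set (CutProject.TotalSpace d (k - d)), CutProject.IsPatchShape α Ω →
        (∀ r : ℝ, 0 < r → ∀ s, D.IsRegular s → ∀ y' ∈ D.pointSet s, ∃ ξ : ℝ,
          D.HasFrequency (D.patchII (r • Ω))
            (CutProject.patchClass (D.patchII (r • Ω)) s y') ξ ∧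
          ∀ y ∈ D.pointSet s, ∀ R : ℝ, 2 ≤ R →
            |D.freqEstimate (D.patchII (r • Ω))
                (CutProject.patchClass (D.patchII (r • Ω)) s y') s y R - ξ|
              ≤ C * (Real.log R ^ ((k : ℝ) + ε) / R ^ d)) ∧
        (∃ r₀ : ℝ, 0 < r₀ ∧
          ∀ r : ℝ, r₀ ≤ r → ∀ s, D.IsRegular s → ∀ y' ∈ D.pointSet s, ∃ ξ : ℝ,
          D.HasFrequency (D.patchI (r • Ω))
            (CutProject.patchClass (D.patchI (r • Ω)) s y') ξ ∧
          ∀ y ∈ D.pointSet s, ∀ R : ℝ, 2 ≤ R →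
            |D.freqEstimate (D.patchI (r • Ω))
                (CutProject.patchClass (D.patchI (r • Ω)) s y') s y R - ξ|
              ≤ C * (Real.log R ^ ((k : ℝ) + ε) * r ^ ((d - 1) * (k - d - 1)) / R ^ d)) := by
  -- The exceptional null set depends on L and ε only, so it serves every F_π. Half of ε is spent on
  -- the almost-everywhere bound and half on absorbing the constant depending on Ω.
  filter_upwards [CutProject.ae_hasSmallDiscrepancy d (k - d) (half_pos hε)] with α hα D
  obtain ⟨C₀, hC₀, hα⟩ := hα
  obtain ⟨C, hC, h⟩ := CutProject.exists_hasUniformFrequencies hd (Nat.sub_pos_of_lt hdk)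
    (by positivity) (half_pos hε) hC₀ hα D
  have hexp : (d : ℝ) + (k - d : ℕ) + ε / 2 + ε / 2 = (k : ℝ) + ε := by
    rw [Nat.cast_sub hdk.le]; ring
  rw [hexp] at h
  refine ⟨C, hC, fun Ω hΩ => ⟨fun r hr s hs y' hy' => ?_, ?_⟩⟩
  · obtain ⟨ξ, h1, h2⟩ := (h Ω hΩ).1 r hr s hs y' hy'
    exact ⟨ξ, h1, h2 s hs⟩
  · obtain ⟨r₀, hr₀, h'⟩ := (h Ω hΩ).2
    refine ⟨r₀, hr₀, fun r hr s hs y' hy' => ?_⟩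
    obtain ⟨ξ, h1, h2⟩ := h' r hr s hs y' hy'
    exact ⟨ξ, h1, h2 s hs⟩
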